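/- **Setting.** Let $X$ be a set and $\mathcal C$ a non-empty set of functions $X\to\{0,1\}$; all probability distributions are discrete. *Representation dimension.* A distribution $\mathcal P$ on finite sets of functions $X\to\{0,1\}$ is an $(\alpha,\beta)$-probabilistic representation of $\mathcal C$ if for every $c\in\mathcal C$ and every distribution $D_X$ on $X$, with probability at least $1-\beta$ over $H\sim\mathcal P$ there is $h\in H$ with $\Pr_{x\sim D_X}[c(x)\ne h(x)]\le\alpha$. Let $\mathrm{PRdim}(\mathcal C)$ be the minimum of $\max_{H\in\mathrm{supp}(\mathcal P)}\log|H|$ over all $(1/4,1/4)$-probabilistic representations $\mathcal P$ of $\mathcal C$ ($\infty$ if this quantity is infinite for every $\mathcal P$). *Learning.* Let $Z=X\times\{0,1\}$. A randomized algorithm $A$ for $n$ users with $m$ examples each maps an input in $(Z^m)^n$ to a random function $X\to\{0,1\}$. It is $\varepsilon$-user-level DP (pure DP, $\delta=0$) if $\Pr[A(\mathbf z)\in S]\le e^{\varepsilon}\Pr[A(\mathbf z')\in S]$ for every set $S$ and all inputs $\mathbf z,\mathbf z'$ that differ only in the examples of one user. It solves $\mathrm{PAC}(\mathcal C;\alpha)$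 if for every distribution $D$ on $Z$ that is realizable by $\mathcal C$ (that is, $\Pr_{(x,y)\sim D}[c^*(x)\ne y]=0$ for some $c^*\in\mathcal C$), when the $nm$ examples are drawn i.i.d. from $D$, with probability at least $2/3$ over the examples and the randomness of $A$ the output $h$ satisfies $\Pr_{(x,y)\sim D}[h(x)\ne y]\le\alpha$. Let $n_m^{\mathrm{PAC}(\mathcal C;\alpha)}(\varepsilon)\in\{0,1,2,\dots\}\cup\{\infty\}$ be the smallest number $n$ of users for which some $\varepsilon$-user-level DP algorithm with $m$ examples per user solves $\mathrm{PAC}(\mathcal C;\alpha)$. **Theorem 1.2.** There are absolute constants $\alpha_0,\varepsilon_0,a,b>0$ and $k\in\mathbb N$ such that the following holds for every set $X$, every non-empty $\mathcal C\subseteq\{0,1\}^X$, all $0<\alpha\le\alpha_0$, $0<\varepsilon\le\varepsilon_0$, and all integers $m\ge1$. Let $d=\mathrm{PRdim}(\mathcal C)$. If $d=\infty$, then $n_m^{\mathrm{PAC}(\mathcal C;\alpha)}(\varepsilon)=\infty$. If $d<\infty$, put $$f=\frac d\varepsilon+\frac d{\varepsilon\alpha m}.$$ Then $$n_m^{\mathrm{PAC}(\mathcal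 C;\alpha)}(\varepsilon)\le b\, f\,\log^k\!\left(2+f+\tfrac1\alpha\right),$$ and, unless $\mathcal C=\{c,1-c\}$ for some $c:X\to\{0,1\}$, $$n_m^{\mathrm{PAC}(\mathcal C;\alpha)}(\varepsilon)\ge \frac{a\,f}{\log^k(2+f)}.$$ -/

import Mathlib

open scoped ENNReal NNReal

universe u

namespace UserDP

/-- The law of `n` independent samples from the (discrete) distribution `D`;
`iid_apply` below gives its mass function. -/
noncomputable def iid {α : Type*} (D : PMF α) : (n : ℕ) → PMF (Fin n → α)
  | 0 => PMF.pure Fin.elim0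
  | n + 1 => D.bind fun x => (iid D n).map fun xs => (Fin.cons x xs : Fin (n + 1) → α)

theorem iid_apply {α : Type*} (D : PMF α) :
    ∀ (n : ℕ) (z : Fin n → α), iid D n z = ∏ i, D (z i)
  | 0, z => by
    have h : z = Fin.elim0 := Subsingleton.elim _ _
    subst h
    simp [iid]
  | n + 1, z => by
    classical
    rw [iid, PMF.bind_apply, tsum_eq_single (z 0), PMF.map_apply,
      tsum_eq_single (Fin.tail z), Fin.prod_univ_succ]
    · simp [iid_apply D n, Fin.tail]
    · intro xs hxs
      rw [if_neg]
      intro h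
      exact hxs (by rw [h, Fin.tail_cons])
    · intro x hx
      rw [PMF.map_apply, ENNReal.tsum_eq_zero.2, mul_zero]
      intro xs
      rw [if_neg]
      intro h
      exact hx (by rw [h, Fin.cons_zero])

/-- An input: `n` users with `m` examples each, from the universe `Z`. -/
abbrev Input (Z : Type*) (n m : ℕ) : Type _ := Fin n → Fin m → Z

/-- A randomized algorithm with `n` users and `m` examples per user, with outputs in `O`. -/
abbrev Algorithm (Z O : Type*) (n m : ℕ) : Type _ := Input Z n m → PMF O

/-- User-level neighbors: the inputs agree after removing the data of some one user `i`. -/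
def Neighbors {Z : Type*} {n m : ℕ} (x x' : Input Z n m) : Prop :=
  ∃ i : Fin n, ∀ j, j ≠ i → x j = x' j

/-- `(ε, δ)`-user-level differential privacy. -/
def IsUserDP {Z O : Type*} {n m : ℕ} (A : Algorithm Z O n m) (ε δ : ℝ) : Prop :=
  ∀ x x' : Input Z n m, Neighbors x x' → ∀ S : Set O,
    (A x).toOuterMeasure S ≤
      ENNReal.ofReal (Real.exp ε) * (A x').toOuterMeasure S + ENNReal.ofReal δ

/-- A statistical task: the distributions `D` over `Z` that have to be handled, and for each of
them the set of correct answers. -/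
structure Task (Z O : Type*) where
  valid : Set (PMF Z)
  correct : PMF Z → Set O

/-- `A` is `γ`-useful for the task `T`: on `n * m` i.i.d. samples from any valid `D` it outputs a
correct answer with probability at least `γ` (over the samples and the coins of `A`). -/
def IsUseful {Z O : Type*} {n m : ℕ} (T : Task Z O) (A : Algorithm Z O n m) (γ : ℝ) : Prop :=
  ∀ D ∈ T.valid,
    ENNReal.ofReal γ ≤ ((iid (iid D m) n).bind A).toOuterMeasure (T.correct D)

/-- The smallest number `n` of users for which some `(ε, δ)`-user-level DP algorithm with `m`
examples per user is `γ`-useful for `T` (`⊤` if there is none). -/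
noncomputable def userComplexity {Z O : Type*} (T : Task Z O) (m : ℕ) (ε δ γ : ℝ) : ℕ∞ :=
  ⨅ n ∈ {n : ℕ | ∃ A : Algorithm Z O n m, IsUserDP A ε δ ∧ IsUseful T A γ}, (n : ℕ∞)

/-- The error `Pr_{(x, y) ∼ D}[c x ≠ y]` of the hypothesis `c`. -/
noncomputable def err {X : Type*} (D : PMF (X × Bool)) (c : X → Bool) : ℝ≥0∞ :=
  D.toOuterMeasure {z | c z.1 ≠ z.2}

/-- Realizable PAC learning of `C` to error `α`, with arbitrary hypotheses as outputs. -/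
noncomputable def pacTask {X : Type*} (C : Set (X → Bool)) (α : ℝ) :
    Task (X × Bool) (X → Bool) where
  valid := {D | ∃ c ∈ C, err D c = 0}
  correct := fun D => {h | err D h ≤ ENNReal.ofReal α}

/-- The distribution `P` on finite classes of hypotheses is an `(α, β)`-probabilistic
representation of `C`. -/
def IsPR {X : Type*} (P : PMF (Finset (X → Bool))) (C : Set (X → Bool)) (α β : ℝ) : Prop :=
  ∀ c ∈ C, ∀ D : PMF X,
    ENNReal.ofReal (1 - β) ≤
      P.toOuterMeasure {H | ∃ h ∈ H, D.toOuterMeasure {x | c x ≠ h x} ≤ ENNReal.ofReal α}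

/-- The largest `log |H|` over the support of `P`, possibly `∞`. (An empty `H` counts as `0`,
like a one-element class.) -/
noncomputable def prSize {X : Type*} (P : PMF (Finset (X → Bool))) : ℝ≥0∞ :=
  ⨆ H ∈ P.support, ENNReal.ofReal (Real.log (H.card : ℝ))

/-- The `(α, β)`-probabilistic representation dimension (`∞` if there is no representation of
finite size). -/
noncomputable def prDimAt {X : Type*} (C : Set (X → Bool)) (α β : ℝ) : ℝ≥0∞ :=
  ⨅ P ∈ {P : PMF (Finset (X → Bool)) | IsPR P C α β}, prSize P

/-- The probabilistic representation dimension. -/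
noncomputable def prDim {X : Type*} (C : Set (X → Bool)) : ℝ≥0∞ := prDimAt C (1 / 4) (1 / 4)

/-- `d / ε + d / (ε α m)` -/
noncomputable def rate (d ε α : ℝ) (m : ℕ) : ℝ := d / ε + d / (ε * α * m)

end UserDP

namespace UserDP

/-! Write `d` for the representation dimension. Up to additive constants it is the least `log (1/q)`
for which a single distribution `μ` on hypotheses puts mass `q` on the `1/4`-good approximations of
every concept under every marginal (`Covers`). A uniform element of a random `H` gives such a `μ`
(`exists_covers_of_isPR`), and about `1/q` independent draws from `μ` give back a representation
(`prDim_le_of_covers`).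

Upper bound. The majority of `T = O(log (1/α))` draws from `μ` is `α/16`-good with probability at
least `q ^ T` (`Covers.boost`). With this as base measure, the exponential mechanism scores a
hypothesis by the number of users who see it err on their first `k = min m ⌊1/α⌋` examples. Put `g =
α k ≤ 1`. A bad hypothesis is caught by a user with probability at least `g/2`, a good one with
probability at most `g/16`. So the expected weight ratio of bad to good shrinks by a factor `1 - Ω(ε
g)` per user, and `n` of order `d T / (ε g)` users beat the mass `q ^ T` (`learner_isUseful`). Since
`1/g ≤ 2 + 1/(α m)`, this is the rate times a logarithm.

Lower bound. Hide an arbitrary marginal `D` with weight `4α` behind a fixed point `x₀`. A user then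
sees anything but `x₀` with probability at most `p = min 1 (4 α m)`, so group privacy lets all users
be replaced by blank ones at a cost of `exp (-O(ε n p))` (`toOuterMeasure_blank_ge`). The blank
input knows only the bit `c x₀`; guessing it yields a covering distribution, whence `d ≤ 12 ε n p +
2`. For small `d` the additive `2` is harmful. There, two concepts that agree at one point and
differ at another force `12 ε n p ≥ 1/7`, and such a pair is missing only in a singleton or in `{c,
1 - c}`. -/

/-! ### Independent samples and discrete laws -/

theorem tsum_pi_prod {α : Type*} :
    ∀ (n : ℕ) (g : Fin n → α → ℝ≥0∞),
      ∑' z : Fin n → α, ∏ i, g i (z i) = ∏ i, ∑' x, g i x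
  | 0, g => by simp
  | n + 1, g => by
    rw [← (Fin.consEquiv fun _ => α).tsum_eq, ENNReal.tsum_prod', Fin.prod_univ_succ,
      ← tsum_pi_prod n, ← ENNReal.tsum_mul_right]
    refine tsum_congr fun x => ?_
    rw [← ENNReal.tsum_mul_left]
    refine tsum_congr fun z => ?_
    simp [Fin.prod_univ_succ, Fin.consEquiv]

theorem tsum_iid_mul_prod {α : Type*} (D : PMF α) (n : ℕ) (f : Fin n → α → ℝ≥0∞) :
    ∑' z, iid D n z * ∏ i, f i (z i) = ∏ i, ∑' x, D x * f i x := by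
  simp only [iid_apply, ← Finset.prod_mul_distrib]
  exact tsum_pi_prod n fun i x => D x * f i x

theorem tsum_iid_mul_coord {α : Type*} (D : PMF α) (n : ℕ) (i : Fin n) (f : α → ℝ≥0∞) :
    ∑' z, iid D n z * f (z i) = ∑' x, D x * f x := by
  have h := tsum_iid_mul_prod D n fun j => if j = i then f else 1
  have h1 : ∀ z : Fin n → α,
      (∏ j, (if j = i then f else (1 : α → ℝ≥0∞)) (z j)) = f (z i) := by
    intro z
    rw [Finset.prod_eq_single i] <;> simp +contextual
  simp only [h1] at h
  rw [h, Finset.prod_eq_single i]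
  · simp
  · intro j _ hj
    simp [hj, D.tsum_coe]
  · simp

theorem tsum_mul_indicator_one {α : Type*} (p : PMF α) (S : Set α) :
    ∑' x, p x * S.indicator 1 x = p.toOuterMeasure S := by
  rw [PMF.toOuterMeasure_apply]
  refine tsum_congr fun x => ?_
  by_cases h : x ∈ S <;> simp [h]

theorem toOuterMeasure_add_compl {α : Type*} (p : PMF α) (S : Set α) :
    p.toOuterMeasure S + p.toOuterMeasure Sᶜ = 1 := by
  rw [PMF.toOuterMeasure_apply, PMF.toOuterMeasure_apply, ← ENNReal.tsum_add, ← p.tsum_coe]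
  refine tsum_congr fun x => ?_
  by_cases h : x ∈ S <;> simp [h]

theorem toOuterMeasure_le_one {α : Type*} (p : PMF α) (S : Set α) : p.toOuterMeasure S ≤ 1 := by
  rw [← toOuterMeasure_add_compl p S]
  exact le_self_add

theorem toOuterMeasure_bind {α β : Type*} (p : PMF α) (f : α → PMF β) (S : Set β) :
    (p.bind f).toOuterMeasure S = ∑' a, p a * (f a).toOuterMeasure S :=
  PMF.toOuterMeasure_bind_apply p f S

theorem iid_toOuterMeasure_forall {α : Type*} (D : PMF α) (n : ℕ) (S : Fin n → Set α) :
    (iid D n).toOuterMeasure {z | ∀ i, z i ∈ S i} = ∏ i, D.toOuterMeasure (S i) := by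
  simp only [← tsum_mul_indicator_one, ← tsum_iid_mul_prod]
  refine tsum_congr fun z => ?_
  congr 1
  by_cases h : ∀ i, z i ∈ S i
  · simp [h]
  · rw [Set.indicator_of_notMem (by exact h)]
    push Not at h
    obtain ⟨i, hi⟩ := h
    exact (Finset.prod_eq_zero (Finset.mem_univ i) (by simp [hi])).symm

theorem iid_toOuterMeasure_exists_le {α : Type*} (D : PMF α) (n : ℕ) (s : Finset (Fin n))
    (S : Set α) :
    (iid D n).toOuterMeasure {z | ∃ i ∈ s, z i ∈ S} ≤ s.card * D.toOuterMeasure S := by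
  calc (iid D n).toOuterMeasure {z | ∃ i ∈ s, z i ∈ S}
      = ∑' z, iid D n z * Set.indicator {z | ∃ i ∈ s, z i ∈ S} 1 z :=
        (tsum_mul_indicator_one _ _).symm
    _ ≤ ∑' z, iid D n z * ∑ i ∈ s, S.indicator 1 (z i) := by
        refine ENNReal.tsum_le_tsum fun z => mul_le_mul_right ?_ _
        by_cases h : ∃ i ∈ s, z i ∈ S
        · obtain ⟨i, hi, hz⟩ := h
          rw [Set.indicator_of_mem (show z ∈ {z | ∃ i ∈ s, z i ∈ S} from ⟨i, hi, hz⟩)]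
          refine le_trans ?_
            (Finset.single_le_sum (f := fun i => S.indicator (1 : α → ℝ≥0∞) (z i))
              (fun _ _ => zero_le) hi)
          simp [hz]
        · rw [Set.indicator_of_notMem (by exact h)]
          exact zero_le
    _ = ∑ i ∈ s, ∑' z, iid D n z * S.indicator 1 (z i) := by
        simp only [Finset.mul_sum]
        exact Summable.tsum_finsetSum fun _ _ => ENNReal.summable
    _ = s.card * D.toOuterMeasure S := by
        simp [tsum_iid_mul_coord, tsum_mul_indicator_one]

/-! ### Representations versus covering distributions -/

/-- `μ` puts mass at least `q` on the `α`-good approximations of any `c ∈ C` under any `D`. -/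
def Covers {X : Type*} (μ : PMF (X → Bool)) (C : Set (X → Bool)) (q α : ℝ≥0∞) : Prop :=
  ∀ c ∈ C, ∀ D : PMF X, q ≤ μ.toOuterMeasure {h | D.toOuterMeasure {x | c x ≠ h x} ≤ α}

theorem card_le_exp_of_prSize_le {X : Type*} {P : PMF (Finset (X → Bool))} {s : ℝ} (hs : 0 ≤ s)
    (h : prSize P ≤ ENNReal.ofReal s) {H : Finset (X → Bool)} (hH : H ∈ P.support) :
    (H.card : ℝ) ≤ Real.exp s := by
  have h1 : ENNReal.ofReal (Real.log (H.card : ℝ)) ≤ ENNReal.ofReal s :=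
    le_trans (le_iSup₂ (f := fun H (_ : H ∈ P.support) =>
      ENNReal.ofReal (Real.log (H.card : ℝ))) H hH) h
  rw [ENNReal.ofReal_le_ofReal_iff hs] at h1
  rcases Nat.eq_zero_or_pos H.card with h0 | h0
  · simp [h0, Real.exp_nonneg]
  · exact (Real.log_le_iff_le_exp (by exact_mod_cast h0)).1 h1

open Classical in
/-- A uniformly random element of `H` (arbitrary if `H` is empty). -/
noncomputable def uniformOr {O : Type*} [Inhabited O] (H : Finset O) : PMF O :=
  if h : H.Nonempty then PMF.uniformOfFinset H h else PMF.pure default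

theorem inv_card_le_uniformOr {O : Type*} [Inhabited O] (H : Finset O) (S : Set O)
    (h : ∃ o ∈ H, o ∈ S) : (H.card : ℝ≥0∞)⁻¹ ≤ (uniformOr H).toOuterMeasure S := by
  obtain ⟨o, ho, hS⟩ := h
  have hne : H.Nonempty := ⟨o, ho⟩
  rw [uniformOr, dif_pos hne, PMF.toOuterMeasure_apply]
  refine le_trans ?_ (ENNReal.le_tsum o)
  rw [Set.indicator_of_mem hS, PMF.uniformOfFinset_apply_of_mem _ ho]

/-- A random `H` contains a good hypothesis with probability `1 - β`, and a uniform element of `H`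
hits it with probability at least `1 / |H| ≥ exp (-s)`. -/
theorem exists_covers_of_isPR {X : Type*} {P : PMF (Finset (X → Bool))} {C : Set (X → Bool)}
    {α β s : ℝ} (hP : IsPR P C α β) (hs : 0 ≤ s) (h : prSize P ≤ ENNReal.ofReal s) :
    ∃ μ, Covers μ C (ENNReal.ofReal ((1 - β) * Real.exp (-s))) (ENNReal.ofReal α) := by
  refine ⟨P.bind uniformOr, fun c hc D => ?_⟩
  rw [toOuterMeasure_bind]
  set G := {h : X → Bool | D.toOuterMeasure {x | c x ≠ h x} ≤ ENNReal.ofReal α}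
  calc ENNReal.ofReal ((1 - β) * Real.exp (-s))
      = ENNReal.ofReal (1 - β) * ENNReal.ofReal (Real.exp (-s)) :=
        ENNReal.ofReal_mul' (Real.exp_nonneg _)
    _ ≤ P.toOuterMeasure {H | ∃ h ∈ H, h ∈ G} * ENNReal.ofReal (Real.exp (-s)) :=
        mul_le_mul_left (hP c hc D) _
    _ = ∑' H, P H * Set.indicator {H | ∃ h ∈ H, h ∈ G} 1 H * ENNReal.ofReal (Real.exp (-s)) := by
        rw [← tsum_mul_indicator_one, ENNReal.tsum_mul_right]
    _ ≤ ∑' H, P H * (uniformOr H).toOuterMeasure G := by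
        refine ENNReal.tsum_le_tsum fun H => ?_
        by_cases hH : H ∈ P.support
        · rw [mul_assoc]
          refine mul_le_mul_right ?_ _
          by_cases hG : ∃ h ∈ H, h ∈ G
          · rw [Set.indicator_of_mem (by exact hG), Pi.one_apply, one_mul]
            refine le_trans ?_ (inv_card_le_uniformOr H G hG)
            have hcard := card_le_exp_of_prSize_le hs h hH
            have hpos : (0 : ℝ) < H.card := by
              obtain ⟨o, ho, _⟩ := hG
              exact_mod_cast Finset.card_pos.2 ⟨o, ho⟩
            rw [← ENNReal.ofReal_natCast, ← ENNReal.ofReal_inv_of_pos hpos]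
            apply ENNReal.ofReal_le_ofReal
            rw [Real.exp_neg]
            gcongr
          · rw [Set.indicator_of_notMem (by exact hG), zero_mul]
            exact zero_le
        · rw [(P.apply_eq_zero_iff H).2 hH]
          simp

/-- All of `N` independent draws from `μ` miss the good set with probability at most `(1 - q) ^ N`,
so the set of draws is a representation of size at most `N`. -/
theorem prDim_le_of_covers {X : Type*} {μ : PMF (X → Bool)} {C : Set (X → Bool)} {q : ℝ≥0∞}
    (hμ : Covers μ C q (ENNReal.ofReal (1 / 4))) (N : ℕ)
    (hN : (1 - q) ^ N ≤ ENNReal.ofReal (1 / 4)) :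
    prDim C ≤ ENNReal.ofReal (Real.log N) := by
  classical
  let P : PMF (Finset (X → Bool)) := (iid μ N).map fun hs => Finset.univ.image hs
  have hP : IsPR P C (1 / 4) (1 / 4) := by
    intro c hc D
    set G := {h : X → Bool | D.toOuterMeasure {x | c x ≠ h x} ≤ ENNReal.ofReal (1 / 4)} with hG
    have h1 : P.toOuterMeasure {H | ∃ h ∈ H, h ∈ G}ᶜ ≤ ENNReal.ofReal (1 / 4) := by
      have h2 : (fun hs : Fin N → X → Bool => Finset.univ.image hs) ⁻¹' {H | ∃ h ∈ H, h ∈ G}ᶜ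
          = {hs | ∀ i, hs i ∈ Gᶜ} := by
        ext hs
        simp
      rw [PMF.toOuterMeasure_map_apply, h2, iid_toOuterMeasure_forall μ N fun _ => Gᶜ,
        Finset.prod_const, Finset.card_univ, Fintype.card_fin]
      refine le_trans (pow_le_pow_left₀ zero_le ?_ N) hN
      have h3 := toOuterMeasure_add_compl μ G
      have h4 : q ≤ μ.toOuterMeasure G := hμ c hc D
      refine ENNReal.le_sub_of_add_le_left
        (ne_top_of_le_ne_top ENNReal.one_ne_top (h4.trans (toOuterMeasure_le_one _ _))) ?_
      rw [← h3]
      gcongr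
    have h5 := toOuterMeasure_add_compl P {H | ∃ h ∈ H, h ∈ G}
    rw [ENNReal.ofReal_sub _ (by norm_num), ENNReal.ofReal_one, tsub_le_iff_right]
    calc (1 : ℝ≥0∞) = _ := h5.symm
      _ ≤ _ := add_le_add_right h1 _
  refine le_trans (iInf₂_le P hP) (iSup₂_le fun H hH => ENNReal.ofReal_le_ofReal ?_)
  obtain ⟨hs, -, rfl⟩ := (PMF.mem_support_map_iff _ _ _).1 hH
  have hcard : (Finset.univ.image hs).card ≤ N := by
    simpa using Finset.card_image_le (s := Finset.univ) (f := hs)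
  rcases Nat.eq_zero_or_pos (Finset.univ.image hs).card with h0 | h0
  · rw [h0]
    simpa using Real.log_natCast_nonneg N
  · exact Real.log_le_log (by exact_mod_cast h0) (by exact_mod_cast hcard)

/-! ### Boosting the accuracy by multiplicative weights -/

theorem tsum_restrict_le_of_covers {X : Type*} {μ : PMF (X → Bool)} {C : Set (X → Bool)}
    {q α : ℝ≥0∞} (hμ : Covers μ C q α) {c : X → Bool} (hc : c ∈ C) (hq : q ≤ 1)
    (W : X → ℝ≥0∞) (hW : ∑' x, W x ≠ ∞) :
    q ≤ μ.toOuterMeasure {h | ∑' x, Set.indicator {x | c x ≠ h x} W x ≤ α * ∑' x, W x} := by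
  by_cases h0 : ∑' x, W x = 0
  · have h1 : {h : X → Bool | ∑' x, Set.indicator {x | c x ≠ h x} W x ≤ α * ∑' x, W x}
        = Set.univ := by
      have hz : W = 0 := funext (ENNReal.tsum_eq_zero.1 h0)
      simp [hz]
    rw [h1]
    have := toOuterMeasure_add_compl μ Set.univ
    rw [Set.compl_univ, MeasureTheory.measure_empty, add_zero] at this
    rwa [this]
  · refine (hμ c hc (PMF.normalize W h0 hW)).trans (MeasureTheory.measure_mono ?_)
    intro h hh
    simp only [Set.mem_ofPred_eq, PMF.toOuterMeasure_apply] at hh ⊢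
    have h2 : ∀ x, Set.indicator {x | c x ≠ h x} (PMF.normalize W h0 hW) x
        = Set.indicator {x | c x ≠ h x} W x * (∑' x, W x)⁻¹ := by
      intro x
      by_cases hx : c x ≠ h x
      · simp [hx, PMF.normalize_apply]
      · push Not at hx
        simp [hx]
    simp only [h2, ENNReal.tsum_mul_right] at hh
    rwa [← div_eq_mul_inv, ENNReal.div_le_iff h0 hW] at hh

/-- The factor by which a hypothesis changes the weight of a point: halved if it is correct
there, doubled if it is wrong. -/
noncomputable def boostFactor (b b' : Bool) : ℝ≥0∞ := if b = b' then 2⁻¹ else 2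

/-- The factor is `1/2` plus `3/2` on mistakes, and `1/2 + 3/2 · 1/4 = 7/8`. -/
theorem tsum_mul_boostFactor_le {X : Type*} (c h : X → Bool) (W : X → ℝ≥0∞)
    (hh : ∑' x, Set.indicator {x | c x ≠ h x} W x ≤ ENNReal.ofReal (1 / 4) * ∑' x, W x) :
    ∑' x, W x * boostFactor (c x) (h x) ≤ ENNReal.ofReal (7 / 8) * ∑' x, W x := by
  have h1 : ∀ x, W x * boostFactor (c x) (h x)
      = 2⁻¹ * W x + ENNReal.ofReal (3 / 2) * Set.indicator {x | c x ≠ h x} W x := by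
    intro x
    by_cases hx : c x = h x
    · simp [boostFactor, hx, mul_comm]
    · rw [boostFactor, if_neg hx, Set.indicator_of_mem (by exact hx), ← add_mul, mul_comm]
      congr 1
      have : (2⁻¹ : ℝ≥0∞) = ENNReal.ofReal (1 / 2) := by
        rw [one_div, ENNReal.ofReal_inv_of_pos two_pos]; simp
      rw [this, ← ENNReal.ofReal_add (by norm_num) (by norm_num)]
      norm_num
  simp only [h1, ENNReal.tsum_add, ENNReal.tsum_mul_left]
  have h2 : (2⁻¹ : ℝ≥0∞) = ENNReal.ofReal (1 / 2) := by
    rw [one_div, ENNReal.ofReal_inv_of_pos two_pos]; simp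
  calc 2⁻¹ * ∑' x, W x + ENNReal.ofReal (3 / 2) * ∑' x, Set.indicator {x | c x ≠ h x} W x
      ≤ ENNReal.ofReal (1 / 2) * ∑' x, W x
        + ENNReal.ofReal (3 / 2) * (ENNReal.ofReal (1 / 4) * ∑' x, W x) := by
        rw [h2]; gcongr
    _ = ENNReal.ofReal (7 / 8) * ∑' x, W x := by
        rw [← mul_assoc, ← ENNReal.ofReal_mul (by norm_num), ← add_mul,
          ← ENNReal.ofReal_add (by norm_num) (by norm_num)]
        norm_num

/-- Covering holds for every marginal, hence for the current weights whatever the earlier draws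
were. Each fresh draw therefore shrinks the total weight by `7/8` with probability at least `q`. The
induction is on arbitrary finite weights because they change after every draw. -/
theorem pow_le_iid_potential {X : Type*} {μ : PMF (X → Bool)} {C : Set (X → Bool)}
    {q : ℝ≥0∞} (hμ : Covers μ C q (ENNReal.ofReal (1 / 4))) {c : X → Bool} (hc : c ∈ C)
    (hq : q ≤ 1) :
    ∀ (T : ℕ) (W : X → ℝ≥0∞), ∑' x, W x ≠ ∞ →
      q ^ T ≤ (iid μ T).toOuterMeasure {hs | ∑' x, W x * ∏ i, boostFactor (c x) (hs i x) ≤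
        ENNReal.ofReal (7 / 8) ^ T * ∑' x, W x}
  | 0, W, hW => by
    simp only [iid, PMF.toOuterMeasure_pure_apply, Fin.prod_univ_zero, mul_one, pow_zero, one_mul]
    split_ifs with h
    · exact le_rfl
    · exact (h (le_refl (∑' x, W x))).elim
  | T + 1, W, hW => by
    rw [iid, toOuterMeasure_bind, pow_succ']
    set G := {h : X → Bool | ∑' x, Set.indicator {x | c x ≠ h x} W x ≤
      ENNReal.ofReal (1 / 4) * ∑' x, W x} with hG
    calc q * q ^ T ≤ μ.toOuterMeasure G * q ^ T :=
          mul_le_mul_left (tsum_restrict_le_of_covers hμ hc hq W hW) _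
      _ = ∑' h, μ h * G.indicator 1 h * q ^ T := by
          rw [← tsum_mul_indicator_one, ENNReal.tsum_mul_right]
      _ ≤ _ := by
          refine ENNReal.tsum_le_tsum fun h => ?_
          rw [mul_assoc]
          refine mul_le_mul_right ?_ _
          by_cases hh : h ∈ G
          · rw [Set.indicator_of_mem hh, Pi.one_apply, one_mul, PMF.toOuterMeasure_map_apply]
            have h1 := tsum_mul_boostFactor_le c h W hh
            have h2 : ∑' x, W x * boostFactor (c x) (h x) ≠ ∞ :=
              ne_top_of_le_ne_top (ENNReal.mul_ne_top ENNReal.ofReal_ne_top hW) h1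
            refine (pow_le_iid_potential hμ hc hq T _ h2).trans (MeasureTheory.measure_mono ?_)
            intro hs hhs
            simp only [Set.mem_ofPred_eq, Set.mem_preimage, Fin.prod_univ_succ, Fin.cons_zero,
              Fin.cons_succ, ← mul_assoc] at hhs ⊢
            refine hhs.trans ?_
            rw [pow_succ, mul_assoc]
            gcongr
          · rw [Set.indicator_of_notMem hh, zero_mul]
            exact zero_le

/-- The majority vote (ties are resolved to `false`). -/
def majority {X : Type*} {T : ℕ} (hs : Fin T → X → Bool) (x : X) : Bool :=
  decide (T < 2 * (Finset.univ.filter fun i => hs i x = true).card)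

/-- Where the majority errs, at least half of the votes are wrong, so the doublings outweigh the
halvings. Only the weak inequality is needed, so ties may go either way. -/
theorem one_le_prod_boostFactor {X : Type*} {T : ℕ} (c : X → Bool) (hs : Fin T → X → Bool)
    (x : X) (h : c x ≠ majority hs x) : 1 ≤ ∏ i, boostFactor (c x) (hs i x) := by
  have hcard : (Finset.univ.filter fun i => hs i x = true).card
      + (Finset.univ.filter fun i => ¬ hs i x = true).card = T := by
    simpa using Finset.card_filter_add_card_filter_not (s := (Finset.univ : Finset (Fin T)))
      (fun i => hs i x = true)
  have hle : (Finset.univ.filter fun i => c x = hs i x).card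
      ≤ (Finset.univ.filter fun i => ¬ c x = hs i x).card := by
    cases hc : c x
    · have hm : majority hs x = true := by simpa [hc] using h
      rw [majority, decide_eq_true_eq] at hm
      have e1 : (Finset.univ.filter fun i => false = hs i x)
          = Finset.univ.filter fun i => ¬ hs i x = true := by
        ext i; cases h : hs i x <;> simp [h]
      have e2 : (Finset.univ.filter fun i => ¬ false = hs i x)
          = Finset.univ.filter fun i => hs i x = true := by
        ext i; cases h : hs i x <;> simp [h]
      rw [e1, e2]
      omega
    · have hm : majority hs x = false := by simpa [hc] using h
      rw [majority, decide_eq_false_iff_not] at hm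
      have e1 : (Finset.univ.filter fun i => true = hs i x)
          = Finset.univ.filter fun i => hs i x = true := by
        ext i; cases h : hs i x <;> simp [h]
      have e2 : (Finset.univ.filter fun i => ¬ true = hs i x)
          = Finset.univ.filter fun i => ¬ hs i x = true := by
        ext i; cases h : hs i x <;> simp [h]
      rw [e1, e2]
      omega
  simp only [boostFactor]
  rw [Finset.prod_ite, Finset.prod_const, Finset.prod_const]
  calc (1 : ℝ≥0∞) = 2⁻¹ ^ _ * 2 ^ (Finset.univ.filter fun i => c x = hs i x).card := by
        rw [← mul_pow, ENNReal.inv_mul_cancel two_ne_zero ENNReal.ofNat_ne_top, one_pow]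
    _ ≤ _ := by
        gcongr
        exact one_le_two

theorem Covers.boost {X : Type*} {μ : PMF (X → Bool)} {C : Set (X → Bool)}
    {q : ℝ≥0∞} (hμ : Covers μ C q (ENNReal.ofReal (1 / 4))) (hq : q ≤ 1) (T : ℕ) :
    Covers ((iid μ T).map majority) C (q ^ T) (ENNReal.ofReal (7 / 8) ^ T) := by
  intro c hc D
  rw [PMF.toOuterMeasure_map_apply]
  refine (pow_le_iid_potential hμ hc hq T D D.tsum_coe_ne_top).trans
    (MeasureTheory.measure_mono ?_)
  intro hs hhs
  simp only [Set.mem_ofPred_eq, Set.mem_preimage, D.tsum_coe, mul_one] at hhs ⊢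
  refine le_trans ?_ hhs
  rw [PMF.toOuterMeasure_apply]
  refine ENNReal.tsum_le_tsum fun x => ?_
  by_cases hx : c x ≠ majority hs x
  · rw [Set.indicator_of_mem (by exact hx)]
    exact le_mul_of_one_le_right' (one_le_prod_boostFactor c hs x hx)
  · rw [Set.indicator_of_notMem (by exact hx)]
    exact zero_le

/-! ### The exponential mechanism -/

/-- Cauchy–Schwarz, by symmetrizing the double sum and using `x/y + y/x ≥ 2`. -/
theorem sq_tsum_le_tsum_mul_tsum {O : Type*} (a w : O → ℝ≥0∞) (hw0 : ∀ o, w o ≠ 0)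
    (hwt : ∀ o, w o ≠ ∞) :
    (∑' o, a o) * (∑' o, a o) ≤ (∑' o, a o * w o) * ∑' o, a o * (w o)⁻¹ := by
  have hA : ∀ f g : O → ℝ≥0∞, (∑' o, f o) * (∑' o, g o) = ∑' o, ∑' o', f o * g o' := by
    intro f g
    rw [← ENNReal.tsum_mul_right]
    simp only [ENNReal.tsum_mul_left]
  have hpt : ∀ x y : ℝ≥0∞, x ≠ 0 → x ≠ ∞ → y ≠ 0 → y ≠ ∞ → 2 ≤ x * y⁻¹ + y * x⁻¹ := by
    intro x y hx0 hxt hy0 hyt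
    lift x to ℝ≥0 using hxt
    lift y to ℝ≥0 using hyt
    have hx : x ≠ 0 := by exact_mod_cast hx0
    have hy : y ≠ 0 := by exact_mod_cast hy0
    rw [← ENNReal.coe_inv hx, ← ENNReal.coe_inv hy]
    norm_cast
    rw [← NNReal.coe_le_coe]
    push_cast
    have hx' : (0 : ℝ) < x := by exact_mod_cast pos_iff_ne_zero.2 hx
    have hy' : (0 : ℝ) < y := by exact_mod_cast pos_iff_ne_zero.2 hy
    rw [← div_eq_mul_inv, ← div_eq_mul_inv, div_add_div _ _ hy'.ne' hx'.ne',
      le_div_iff₀ (by positivity)]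
    nlinarith [sq_nonneg ((x : ℝ) - y)]
  have h2 : (2 : ℝ≥0∞) * ((∑' o, a o) * (∑' o, a o))
      ≤ 2 * ((∑' o, a o * w o) * ∑' o, a o * (w o)⁻¹) := by
    calc (2 : ℝ≥0∞) * ((∑' o, a o) * (∑' o, a o))
        = ∑' o, ∑' o', a o * a o' * 2 := by
          rw [hA, mul_comm]; simp only [ENNReal.tsum_mul_right]
      _ ≤ ∑' o, ∑' o', (a o * w o * (a o' * (w o')⁻¹) + a o * (w o)⁻¹ * (a o' * w o')) := by
          refine ENNReal.tsum_le_tsum fun o => ENNReal.tsum_le_tsum fun o' => ?_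
          calc a o * a o' * 2 ≤ a o * a o' * (w o * (w o')⁻¹ + w o' * (w o)⁻¹) := by
                gcongr
                exact hpt _ _ (hw0 _) (hwt _) (hw0 _) (hwt _)
            _ = _ := by ring
      _ = _ := by
          simp only [ENNReal.tsum_add]
          rw [← hA, ← hA]
          ring
  exact (ENNReal.mul_le_mul_iff_right two_ne_zero ENNReal.ofNat_ne_top).1 h2

section ExpMech

variable {O : Type*} (μ : PMF O) (w : O → ℝ≥0∞)

theorem tsum_mul_ne_zero (hw0 : ∀ o, w o ≠ 0) : ∑' o, μ o * w o ≠ 0 := by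
  intro h
  obtain ⟨o, ho⟩ := μ.support_nonempty
  have := ENNReal.tsum_eq_zero.1 h o
  rcases mul_eq_zero.1 this with h1 | h1
  · exact (μ.mem_support_iff o).1 ho h1
  · exact hw0 o h1

theorem tsum_mul_ne_top (hw1 : ∀ o, w o ≤ 1) : ∑' o, μ o * w o ≠ ∞ := by
  refine ne_top_of_le_ne_top μ.tsum_coe_ne_top (ENNReal.tsum_le_tsum fun o => ?_)
  exact mul_le_of_le_one_right' (hw1 o)

/-- The exponential mechanism with base measure `μ` and weights `w`. -/
noncomputable def expMech (hw0 : ∀ o, w o ≠ 0) (hw1 : ∀ o, w o ≤ 1) : PMF O :=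
  PMF.normalize (fun o => μ o * w o) (tsum_mul_ne_zero μ w hw0) (tsum_mul_ne_top μ w hw1)

/-- One factor `K` comes from the weight, the other from the normalizing sum. -/
theorem expMech_apply_le (hw0 : ∀ o, w o ≠ 0) (hw1 : ∀ o, w o ≤ 1) (w' : O → ℝ≥0∞)
    (hw0' : ∀ o, w' o ≠ 0) (hw1' : ∀ o, w' o ≤ 1) (K : ℝ≥0∞) (hK0 : K ≠ 0) (hKt : K ≠ ∞)
    (h : ∀ o, w o ≤ K * w' o) (h' : ∀ o, w' o ≤ K * w o) (o : O) :
    expMech μ w hw0 hw1 o ≤ K * K * expMech μ w' hw0' hw1' o := by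
  simp only [expMech, PMF.normalize_apply]
  have hZ : (∑' o, μ o * w o)⁻¹ ≤ K * (∑' o, μ o * w' o)⁻¹ := by
    rw [← inv_inv K, ← ENNReal.mul_inv (Or.inl (by simpa using hKt)) (Or.inl (by simpa using hK0)),
      ENNReal.inv_le_inv, ← ENNReal.div_eq_inv_mul, ENNReal.div_le_iff hK0 hKt,
      ← ENNReal.tsum_mul_right]
    refine ENNReal.tsum_le_tsum fun o => ?_
    rw [mul_assoc, mul_comm (w o)]
    exact mul_le_mul_right (h' o) _
  calc μ o * w o * (∑' o, μ o * w o)⁻¹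
      ≤ μ o * (K * w' o) * (K * (∑' o, μ o * w' o)⁻¹) :=
        mul_le_mul' (mul_le_mul_right (h o) _) hZ
    _ = _ := by ring

/-- Restrict the normalizing sum to `G` and bound its inverse by Cauchy–Schwarz. The data then enter
linearly, through the ratios `w b / w h`, whose expectation factors over independent users; no
concentration bound or union bound over hypotheses is needed. -/
theorem expMech_toOuterMeasure_le (hw0 : ∀ o, w o ≠ 0) (hw1 : ∀ o, w o ≤ 1) (B G : Set O)
    (hG : μ.toOuterMeasure G ≠ 0) :
    (expMech μ w hw0 hw1).toOuterMeasure B ≤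
      (μ.toOuterMeasure G * μ.toOuterMeasure G)⁻¹ *
        ∑' b, ∑' h, B.indicator μ b * G.indicator μ h * (w b * (w h)⁻¹) := by
  have hwt : ∀ o, w o ≠ ∞ := fun o => ne_top_of_le_ne_top ENNReal.one_ne_top (hw1 o)
  have hGt : μ.toOuterMeasure G ≠ ∞ :=
    ne_top_of_le_ne_top ENNReal.one_ne_top (toOuterMeasure_le_one _ _)
  have h1 : (expMech μ w hw0 hw1).toOuterMeasure B
      = (∑' b, B.indicator μ b * w b) * (∑' o, μ o * w o)⁻¹ := by
    rw [PMF.toOuterMeasure_apply, ← ENNReal.tsum_mul_right]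
    refine tsum_congr fun b => ?_
    by_cases hb : b ∈ B <;> simp [hb, expMech, PMF.normalize_apply]
  have h2 : (∑' o, μ o * w o)⁻¹ ≤ (μ.toOuterMeasure G * μ.toOuterMeasure G)⁻¹ *
      ∑' h, G.indicator μ h * (w h)⁻¹ := by
    have h3 := sq_tsum_le_tsum_mul_tsum (G.indicator μ) w hw0 hwt
    rw [← PMF.toOuterMeasure_apply] at h3
    have h4 : ∑' h, G.indicator μ h * w h ≤ ∑' o, μ o * w o :=
      ENNReal.tsum_le_tsum fun o => mul_le_mul_left (Set.indicator_le_self _ _ _) _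
    rw [ENNReal.inv_le_iff_le_mul]
    · rw [mul_left_comm, ← ENNReal.div_eq_inv_mul, ENNReal.le_div_iff_mul_le, one_mul]
      · exact h3.trans (mul_le_mul_left h4 _)
      · exact Or.inl (mul_ne_zero hG hG)
      · exact Or.inl (ENNReal.mul_ne_top hGt hGt)
    · exact fun _ => tsum_mul_ne_zero μ w hw0
    · exact fun h => absurd h (tsum_mul_ne_top μ w hw1)
  rw [h1]
  refine (mul_le_mul_right h2 _).trans (le_of_eq ?_)
  rw [mul_left_comm, ← ENNReal.tsum_mul_right]
  congr 1
  refine tsum_congr fun b => ?_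
  rw [← ENNReal.tsum_mul_left]
  refine tsum_congr fun h => ?_
  ring

end ExpMech

theorem tsum_mul_expMech_le {O Z : Type*} (μ : PMF O) (P : PMF Z) (w : Z → O → ℝ≥0∞)
    (hw0 : ∀ z o, w z o ≠ 0) (hw1 : ∀ z o, w z o ≤ 1) (B G : Set O)
    (hG : μ.toOuterMeasure G ≠ 0) (κ : ℝ≥0∞)
    (hκ : ∀ b ∈ B, ∀ h ∈ G, ∑' z, P z * (w z b * (w z h)⁻¹) ≤ κ) :
    (P.bind fun z => expMech μ (w z) (hw0 z) (hw1 z)).toOuterMeasure B ≤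
      κ * (μ.toOuterMeasure G)⁻¹ := by
  have hGt : μ.toOuterMeasure G ≠ ∞ :=
    ne_top_of_le_ne_top ENNReal.one_ne_top (toOuterMeasure_le_one _ _)
  rw [toOuterMeasure_bind]
  set Q := (μ.toOuterMeasure G * μ.toOuterMeasure G)⁻¹ with hQ
  calc ∑' z, P z * (expMech μ (w z) (hw0 z) (hw1 z)).toOuterMeasure B
      ≤ ∑' z, P z * (Q * ∑' b, ∑' h, B.indicator μ b * G.indicator μ h * (w z b * (w z h)⁻¹)) :=
        ENNReal.tsum_le_tsum fun z => mul_le_mul_right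
          (expMech_toOuterMeasure_le μ (w z) (hw0 z) (hw1 z) B G hG) _
    _ = Q * ∑' b, ∑' h, B.indicator μ b * G.indicator μ h *
          ∑' z, P z * (w z b * (w z h)⁻¹) := by
        simp only [mul_left_comm _ Q, ENNReal.tsum_mul_left]
        congr 1
        simp only [← ENNReal.tsum_mul_left]
        rw [ENNReal.tsum_comm]
        refine tsum_congr fun b => ?_
        rw [ENNReal.tsum_comm]
        refine tsum_congr fun h => tsum_congr fun z => ?_
        ring
    _ ≤ Q * ∑' b, ∑' h, B.indicator μ b * G.indicator μ h * κ := by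
        refine mul_le_mul_right (ENNReal.tsum_le_tsum fun b => ENNReal.tsum_le_tsum fun h => ?_) _
        by_cases hb : b ∈ B
        · by_cases hh : h ∈ G
          · exact mul_le_mul_right (hκ b hb h hh) _
          · simp [hh]
        · simp [hb]
    _ = Q * (μ.toOuterMeasure B * μ.toOuterMeasure G * κ) := by
        simp only [ENNReal.tsum_mul_right, ENNReal.tsum_mul_left]
        rw [← PMF.toOuterMeasure_apply, ← PMF.toOuterMeasure_apply]
    _ ≤ Q * (1 * μ.toOuterMeasure G * κ) := by
        gcongr
        exact toOuterMeasure_le_one _ _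
    _ = κ * (μ.toOuterMeasure G)⁻¹ := by
        rw [hQ, ENNReal.mul_inv (Or.inl hG) (Or.inl hGt), one_mul, ← mul_assoc,
          mul_assoc _ _ (μ.toOuterMeasure G), ENNReal.inv_mul_cancel hG hGt, mul_one, mul_comm]

/-! ### The learner: privacy and accuracy -/

theorem exp_neg_le_one_sub_half {x : ℝ} (h0 : 0 ≤ x) (h1 : x ≤ 1) :
    Real.exp (-x) ≤ 1 - x / 2 := by
  rw [Real.exp_neg]
  refine inv_le_of_inv_le₀ (by linarith) ?_
  refine le_trans ?_ (Real.add_one_le_exp x)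
  rw [inv_le_iff_one_le_mul₀ (by linarith)]
  nlinarith

/-- `h` misclassifies one of the first `k` examples of the user. -/
def Mistake {X : Type*} {m : ℕ} (k : ℕ) (h : X → Bool) (u : Fin m → X × Bool) : Prop :=
  ∃ j : Fin m, j.val < k ∧ h (u j).1 ≠ (u j).2

open Classical in
/-- A user whose first `k` examples are not all classified correctly votes `r`. -/
noncomputable def userWeight {X : Type*} {m : ℕ} (r : ℝ≥0∞) (k : ℕ) (h : X → Bool)
    (u : Fin m → X × Bool) : ℝ≥0∞ :=
  if Mistake k h u then r else 1

section Weights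

variable {X : Type*} {m : ℕ} {r : ℝ≥0∞} (k : ℕ) (h : X → Bool)

theorem userWeight_le_one (hr : r ≤ 1) (u : Fin m → X × Bool) : userWeight r k h u ≤ 1 := by
  rw [userWeight]
  split_ifs
  · exact hr
  · exact le_rfl

theorem le_userWeight (hr : r ≤ 1) (u : Fin m → X × Bool) : r ≤ userWeight r k h u := by
  rw [userWeight]
  split_ifs
  · exact le_rfl
  · exact hr

theorem userWeight_ne_zero (hr : r ≤ 1) (hr0 : r ≠ 0) (u : Fin m → X × Bool) :
    userWeight r k h u ≠ 0 := fun h0 =>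
  hr0 (le_antisymm ((le_userWeight k h hr u).trans h0.le) zero_le)

theorem prod_userWeight_le {n : ℕ} (hr : r ≤ 1) (hr0 : r ≠ 0) {z z' : Input (X × Bool) n m}
    (hz : Neighbors z z') :
    ∏ i, userWeight r k h (z i) ≤ r⁻¹ * ∏ i, userWeight r k h (z' i) := by
  classical
  obtain ⟨i, hi⟩ := hz
  have hrt : r ≠ ∞ := ne_top_of_le_ne_top ENNReal.one_ne_top hr
  rw [← Finset.mul_prod_erase _ _ (Finset.mem_univ i),
    ← Finset.mul_prod_erase _ (fun i => userWeight r k h (z' i)) (Finset.mem_univ i), ← mul_assoc]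
  refine mul_le_mul' ?_ (le_of_eq (Finset.prod_congr rfl fun j hj => ?_))
  · refine (userWeight_le_one k h hr _).trans ?_
    rw [← ENNReal.inv_mul_cancel hr0 hrt]
    exact mul_le_mul_right (le_userWeight k h hr _) _
  · rw [hi j (Finset.ne_of_mem_erase hj)]

theorem prod_userWeight_ne_zero {n : ℕ} (hr : r ≤ 1) (hr0 : r ≠ 0) (z : Input (X × Bool) n m) :
    ∏ i, userWeight r k h (z i) ≠ 0 :=
  Finset.prod_ne_zero_iff.2 fun i _ => userWeight_ne_zero k h hr hr0 (z i)

theorem prod_userWeight_le_one {n : ℕ} (hr : r ≤ 1) (z : Input (X × Bool) n m) :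
    ∏ i, userWeight r k h (z i) ≤ 1 :=
  Finset.prod_le_one' fun i _ => userWeight_le_one k h hr (z i)

end Weights

/-- The learner: the exponential mechanism that scores a hypothesis by the number of users with
a misclassified example among their first `k`. -/
noncomputable def learner {X : Type*} (n m k : ℕ) (μ : PMF (X → Bool)) (r : ℝ≥0∞) (hr : r ≤ 1)
    (hr0 : r ≠ 0) : Algorithm (X × Bool) (X → Bool) n m := fun z =>
  expMech μ (fun h => ∏ i, userWeight r k h (z i))
    (fun h => prod_userWeight_ne_zero k h hr hr0 z) (fun h => prod_userWeight_le_one k h hr z)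

theorem Neighbors.symm {Z : Type*} {n m : ℕ} {x x' : Input Z n m} (h : Neighbors x x') :
    Neighbors x' x :=
  h.imp fun _ hi j hj => (hi j hj).symm

theorem learner_isUserDP {X : Type*} (n m k : ℕ) (μ : PMF (X → Bool)) (r : ℝ≥0∞) (hr : r ≤ 1)
    (hr0 : r ≠ 0) {ε : ℝ} (hε : r⁻¹ * r⁻¹ = ENNReal.ofReal (Real.exp ε)) :
    IsUserDP (learner n m k μ r hr hr0) ε 0 := by
  intro z z' hz S
  have hrt : r ≠ ∞ := ne_top_of_le_ne_top ENNReal.one_ne_top hr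
  rw [ENNReal.ofReal_zero, add_zero, PMF.toOuterMeasure_apply, PMF.toOuterMeasure_apply,
    ← ENNReal.tsum_mul_left, ← hε]
  refine ENNReal.tsum_le_tsum fun o => ?_
  by_cases ho : o ∈ S
  · rw [Set.indicator_of_mem ho, Set.indicator_of_mem ho]
    exact expMech_apply_le μ _ _ _ _ _ _ r⁻¹ (ENNReal.inv_ne_zero.2 hrt)
      (ENNReal.inv_ne_top.2 hr0) (fun h => prod_userWeight_le k h hr hr0 hz)
      (fun h => prod_userWeight_le k h hr hr0 hz.symm) o
  · simp [ho]

theorem toOuterMeasure_mistake_le {X : Type*} {m : ℕ} (D : PMF (X × Bool)) (k : ℕ)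
    (h : X → Bool) :
    (iid D m).toOuterMeasure {u | Mistake k h u} ≤ k * err D h := by
  classical
  have h1 : {u : Fin m → X × Bool | Mistake k h u}
      = {u | ∃ j ∈ Finset.univ.filter (fun j : Fin m => j.val < k), u j ∈ {z | h z.1 ≠ z.2}} := by
    ext u
    simp [Mistake]
  rw [h1]
  refine (iid_toOuterMeasure_exists_le D m _ _).trans ?_
  refine mul_le_mul' ?_ le_rfl
  have : (Finset.univ.filter (fun j : Fin m => j.val < k)).card ≤ k := by
    rw [← Finset.card_map Fin.valEmbedding]
    refine (Finset.card_le_card (t := Finset.range k) ?_).trans (by simp)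
    intro i
    simp only [Finset.mem_map, Finset.mem_filter, Finset.mem_range]
    rintro ⟨j, hj, rfl⟩
    exact hj.2
  exact_mod_cast this

theorem toOuterMeasure_not_mistake_le {X : Type*} {m : ℕ} (D : PMF (X × Bool)) {k : ℕ}
    (hk : k ≤ m) (h : X → Bool) {α : ℝ} (hα0 : 0 ≤ α) (hα : ENNReal.ofReal α ≤ err D h) :
    (iid D m).toOuterMeasure {u | ¬ Mistake k h u} ≤ ENNReal.ofReal (1 - α) ^ k := by
  classical
  have h1 : {u : Fin m → X × Bool | ¬ Mistake k h u}
      = {u | ∀ j, u j ∈ if j.val < k then {z : X × Bool | h z.1 ≠ z.2}ᶜ else Set.univ} := by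
    ext u
    simp only [Mistake, Set.mem_ofPred_eq, not_exists, not_and]
    refine forall_congr' fun j => ?_
    split_ifs with hj <;> simp [hj]
  have hc := toOuterMeasure_add_compl D {z : X × Bool | h z.1 ≠ z.2}
  have hle : D.toOuterMeasure {z : X × Bool | h z.1 ≠ z.2}ᶜ ≤ ENNReal.ofReal (1 - α) := by
    rw [ENNReal.ofReal_sub _ hα0, ENNReal.ofReal_one]
    refine ENNReal.le_sub_of_add_le_left ENNReal.ofReal_ne_top ?_
    rw [← hc]
    exact add_le_add_left hα _
  rw [h1, iid_toOuterMeasure_forall]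
  have h2 : ∀ j : Fin m, D.toOuterMeasure
      (if j.val < k then {z : X × Bool | h z.1 ≠ z.2}ᶜ else Set.univ) ≤
        if j.val < k then ENNReal.ofReal (1 - α) else 1 := by
    intro j
    split_ifs
    · exact hle
    · exact toOuterMeasure_le_one _ _
  refine (Finset.prod_le_prod' fun j _ => h2 j).trans (le_of_eq ?_)
  rw [Finset.prod_ite, Finset.prod_const, Finset.prod_const_one, mul_one]
  congr 1
  have h3 : (Finset.univ.filter (fun j : Fin m => j.val < k)).map Fin.valEmbedding
      = Finset.range k := by
    ext i
    simp only [Finset.mem_map, Finset.mem_filter, Finset.mem_range, Finset.mem_univ, true_and]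
    constructor
    · rintro ⟨j, hj, rfl⟩
      exact hj
    · intro hi
      exact ⟨⟨i, hi.trans_le hk⟩, hi, rfl⟩
  rw [← Finset.card_map Fin.valEmbedding, h3, Finset.card_range]

theorem userWeight_ratio_le {X : Type*} {m : ℕ} {ρ : ℝ} (hρ0 : 0 < ρ) (hρ1 : ρ ≤ 1) (k : ℕ)
    (b h : X → Bool) (u : Fin m → X × Bool) :
    userWeight (ENNReal.ofReal ρ) k b u * (userWeight (ENNReal.ofReal ρ) k h u)⁻¹ ≤
      ENNReal.ofReal ρ + ENNReal.ofReal (1 - ρ) * Set.indicator {u | ¬ Mistake k b u} 1 u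
        + ENNReal.ofReal (ρ⁻¹ - 1) * Set.indicator {u | Mistake k h u} 1 u := by
  have hinv : 1 ≤ ρ⁻¹ := (one_le_inv₀ hρ0).2 hρ1
  have hsum : ENNReal.ofReal ρ + ENNReal.ofReal (1 - ρ) = 1 := by
    rw [← ENNReal.ofReal_add hρ0.le (by linarith)]; simp
  have hsum' : 1 + ENNReal.ofReal (ρ⁻¹ - 1) = (ENNReal.ofReal ρ)⁻¹ := by
    rw [← ENNReal.ofReal_one, ← ENNReal.ofReal_add one_pos.le (by linarith),
      ← ENNReal.ofReal_inv_of_pos hρ0]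
    congr 1
    ring
  by_cases hb : Mistake k b u <;> by_cases hh : Mistake k h u
  -- The only case with slack: the ratio is `1` and the bound is `ρ + ρ⁻¹ - 1 ≥ 1`. The other three
  -- are equalities.
  · simp only [userWeight, hb, hh, if_true, Set.mem_ofPred_eq, not_true, not_false_eq_true,
      Set.indicator_of_notMem, Set.indicator_of_mem, Pi.one_apply, mul_zero, add_zero, mul_one]
    rw [ENNReal.mul_inv_cancel (by simpa using hρ0) ENNReal.ofReal_ne_top,
      ← ENNReal.ofReal_add hρ0.le (by linarith), ENNReal.one_le_ofReal]
    have : ρ * ρ⁻¹ = 1 := mul_inv_cancel₀ hρ0.ne'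
    nlinarith [mul_nonneg (sub_nonneg.2 hρ1) (sub_nonneg.2 hinv)]
  · simp [userWeight, hb, hh]
  · simp only [userWeight, hb, hh, if_true, if_false, Set.mem_ofPred_eq, not_false_eq_true,
      Set.indicator_of_mem, Pi.one_apply, mul_one, one_mul]
    rw [hsum, hsum']
  · simp [userWeight, hb, hh, hsum]

/-- Catching `b` gains at least `(1 - ρ) g / 2`, where `g = α k`; wrongly penalizing `h` costs at
most `2 (1 - ρ) g / 16`. The difference is `3/8 (1 - ρ) g`. -/
theorem tsum_iid_userWeight_ratio_le {X : Type*} {m : ℕ} {ρ : ℝ} (hρ0 : 1 / 2 ≤ ρ) (hρ1 : ρ ≤ 1)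
    {k : ℕ} (hk : k ≤ m) (D : PMF (X × Bool)) (b h : X → Bool) {α : ℝ} (hα0 : 0 ≤ α)
    (hα1 : α ≤ 1) (hg : α * k ≤ 1) (hb : ENNReal.ofReal α ≤ err D b)
    (hh : err D h ≤ ENNReal.ofReal (α / 16)) :
    ∑' u, iid D m u *
      (userWeight (ENNReal.ofReal ρ) k b u * (userWeight (ENNReal.ofReal ρ) k h u)⁻¹) ≤
      ENNReal.ofReal (1 - 3 / 8 * (1 - ρ) * (α * k)) := by
  have hρ : 0 < ρ := by linarith
  have hinv : ρ⁻¹ - 1 ≤ 2 * (1 - ρ) := by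
    have h1 : ρ⁻¹ ≤ 2 := by
      rw [inv_le_comm₀ hρ two_pos]; linarith
    have : ρ⁻¹ * ρ = 1 := inv_mul_cancel₀ hρ.ne'
    nlinarith
  have hinv0 : 0 ≤ ρ⁻¹ - 1 := by
    have : 1 ≤ ρ⁻¹ := (one_le_inv₀ hρ).2 hρ1
    linarith
  have hg0 : 0 ≤ α * k := by positivity
  have hpow : (1 - α) ^ k ≤ 1 - α * k / 2 := by
    have h1 : (1 - α) ^ k ≤ Real.exp (-(α * k)) := by
      calc (1 - α) ^ k ≤ Real.exp (-α) ^ k :=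
            pow_le_pow_left₀ (by linarith) (Real.one_sub_le_exp_neg α) k
        _ = Real.exp (-(α * k)) := by rw [← Real.exp_nat_mul]; congr 1; ring
    have h2 := exp_neg_le_one_sub_half hg0 hg
    exact h1.trans h2
  calc ∑' u, iid D m u *
        (userWeight (ENNReal.ofReal ρ) k b u * (userWeight (ENNReal.ofReal ρ) k h u)⁻¹)
      ≤ ∑' u, iid D m u * (ENNReal.ofReal ρ
          + ENNReal.ofReal (1 - ρ) * Set.indicator {u | ¬ Mistake k b u} 1 u
          + ENNReal.ofReal (ρ⁻¹ - 1) * Set.indicator {u | Mistake k h u} 1 u) :=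
        ENNReal.tsum_le_tsum fun u =>
          mul_le_mul_right (userWeight_ratio_le hρ hρ1 k b h u) _
    _ = ENNReal.ofReal ρ + ENNReal.ofReal (1 - ρ) *
          (iid D m).toOuterMeasure {u | ¬ Mistake k b u}
          + ENNReal.ofReal (ρ⁻¹ - 1) * (iid D m).toOuterMeasure {u | Mistake k h u} := by
        simp only [mul_add, ENNReal.tsum_add, ENNReal.tsum_mul_right, (iid D m).tsum_coe, one_mul,
          mul_left_comm _ (ENNReal.ofReal _), ENNReal.tsum_mul_left, tsum_mul_indicator_one]
    _ ≤ ENNReal.ofReal ρ + ENNReal.ofReal (1 - ρ) * ENNReal.ofReal (1 - α * k / 2)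
          + ENNReal.ofReal (2 * (1 - ρ)) * ENNReal.ofReal (k * (α / 16)) := by
        gcongr
        · refine (toOuterMeasure_not_mistake_le D hk b hα0 hb).trans ?_
          rw [← ENNReal.ofReal_pow (by linarith)]
          exact ENNReal.ofReal_le_ofReal hpow
        · refine (toOuterMeasure_mistake_le D k h).trans ?_
          rw [ENNReal.ofReal_mul (by positivity), ENNReal.ofReal_natCast]
          gcongr
    _ = ENNReal.ofReal (1 - 3 / 8 * (1 - ρ) * (α * k)) := by
        rw [← ENNReal.ofReal_mul (by linarith), ← ENNReal.ofReal_mul (by linarith),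
          ← ENNReal.ofReal_add (by linarith) (mul_nonneg (by linarith) (by linarith)),
          ← ENNReal.ofReal_add (add_nonneg (by linarith) (mul_nonneg (by linarith) (by linarith)))
            (mul_nonneg (by linarith) (by positivity))]
        congr 1
        ring

theorem err_le_marginal {X : Type*} (D : PMF (X × Bool)) (c h : X → Bool) (hc : err D c = 0) :
    err D h ≤ (D.map Prod.fst).toOuterMeasure {x | c x ≠ h x} := by
  rw [PMF.toOuterMeasure_map_apply]
  have h1 : {z : X × Bool | h z.1 ≠ z.2} ⊆
      {z | c z.1 ≠ z.2} ∪ Prod.fst ⁻¹' {x | c x ≠ h x} := by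
    intro z hz
    by_cases hcz : c z.1 = z.2
    · right
      intro h2
      exact hz (h2 ▸ hcz)
    · left
      exact hcz
  calc err D h ≤ D.toOuterMeasure ({z | c z.1 ≠ z.2} ∪ Prod.fst ⁻¹' {x | c x ≠ h x}) :=
        MeasureTheory.measure_mono h1
    _ ≤ err D c + D.toOuterMeasure (Prod.fst ⁻¹' {x | c x ≠ h x}) :=
        MeasureTheory.measure_union_le _ _
    _ = _ := by rw [hc, zero_add]

theorem learner_isUseful {X : Type*} {C : Set (X → Bool)} {n m k : ℕ} {μ : PMF (X → Bool)}
    {ρ α : ℝ} (hr : ENNReal.ofReal ρ ≤ 1) (hr0 : ENNReal.ofReal ρ ≠ 0)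
    (hρ0 : 1 / 2 ≤ ρ) (hρ1 : ρ ≤ 1) (hk : k ≤ m) (hα0 : 0 ≤ α) (hα1 : α ≤ 1) (hg : α * k ≤ 1)
    {Q : ℝ≥0∞} (hQ0 : Q ≠ 0) (hμ : Covers μ C Q (ENNReal.ofReal (α / 16)))
    (hn : ENNReal.ofReal (1 - 3 / 8 * (1 - ρ) * (α * k)) ^ n ≤ ENNReal.ofReal (1 / 3) * Q) :
    IsUseful (pacTask C α) (learner n m k μ (ENNReal.ofReal ρ) hr hr0) (2 / 3) := by
  rintro D ⟨c, hc, hD⟩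
  set G := {h : X → Bool | (D.map Prod.fst).toOuterMeasure {x | c x ≠ h x} ≤
    ENNReal.ofReal (α / 16)} with hGdef
  have hQG : Q ≤ μ.toOuterMeasure G := hμ c hc (D.map Prod.fst)
  have hG0 : μ.toOuterMeasure G ≠ 0 := fun h0 => hQ0 (le_antisymm (hQG.trans h0.le) zero_le)
  have hGt : μ.toOuterMeasure G ≠ ∞ :=
    ne_top_of_le_ne_top ENNReal.one_ne_top (toOuterMeasure_le_one _ _)
  have hκ : ∀ b ∈ ((pacTask C α).correct D)ᶜ, ∀ h ∈ G, ∑' z, iid (iid D m) n z *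
      ((∏ i, userWeight (ENNReal.ofReal ρ) k b (z i)) *
        (∏ i, userWeight (ENNReal.ofReal ρ) k h (z i))⁻¹) ≤
      ENNReal.ofReal (1 - 3 / 8 * (1 - ρ) * (α * k)) ^ n := by
    intro b hb h hh
    have hb' : ENNReal.ofReal α ≤ err D b := by
      have : ¬ err D b ≤ ENNReal.ofReal α := hb
      exact (not_le.1 this).le
    have h1 : ∀ z : Input (X × Bool) n m,
        (∏ i, userWeight (ENNReal.ofReal ρ) k b (z i)) *
          (∏ i, userWeight (ENNReal.ofReal ρ) k h (z i))⁻¹ =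
        ∏ i, (userWeight (ENNReal.ofReal ρ) k b (z i) *
          (userWeight (ENNReal.ofReal ρ) k h (z i))⁻¹) := by
      intro z
      rw [Finset.prod_mul_distrib, ENNReal.prod_inv_distrib]
      intro i _ j _ _
      exact Or.inl (userWeight_ne_zero k h hr hr0 (z i))
    simp only [h1]
    rw [tsum_iid_mul_prod (iid D m) n fun _ u => userWeight (ENNReal.ofReal ρ) k b u *
      (userWeight (ENNReal.ofReal ρ) k h u)⁻¹, Finset.prod_const, Finset.card_univ,
      Fintype.card_fin]
    exact pow_le_pow_left₀ zero_le (tsum_iid_userWeight_ratio_le hρ0 hρ1 hk D b h hα0 hα1 hg hb'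
      ((err_le_marginal D c h hD).trans hh)) n
  have hbad : ((iid (iid D m) n).bind (learner n m k μ (ENNReal.ofReal ρ) hr hr0)).toOuterMeasure
      ((pacTask C α).correct D)ᶜ ≤ ENNReal.ofReal (1 / 3) := by
    refine (tsum_mul_expMech_le μ (iid (iid D m) n)
      (fun z h => ∏ i, userWeight (ENNReal.ofReal ρ) k h (z i)) _ _ _ G hG0 _ hκ).trans ?_
    rw [← div_eq_mul_inv, ENNReal.div_le_iff hG0 hGt]
    exact hn.trans (mul_le_mul_right hQG _)
  have h1 := toOuterMeasure_add_compl
    ((iid (iid D m) n).bind (learner n m k μ (ENNReal.ofReal ρ) hr hr0))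
    ((pacTask C α).correct D)
  rw [show (2 / 3 : ℝ) = 1 - 1 / 3 by norm_num, ENNReal.ofReal_sub _ (by norm_num),
    ENNReal.ofReal_one, tsub_le_iff_right, ← h1]
  exact add_le_add_right hbad _

theorem Covers.mono {X : Type*} {μ : PMF (X → Bool)} {C : Set (X → Bool)} {q α α' : ℝ≥0∞}
    (h : Covers μ C q α) (hα : α ≤ α') : Covers μ C q α' := fun c hc D =>
  (h c hc D).trans (MeasureTheory.measure_mono fun _ hh => le_trans hh hα)

/-! ### Choice of parameters for the upper bound -/

theorem sample_size_le {d ε α g T n : ℝ} {m : ℕ} (hd : 2 / 3 ≤ d) (hα : 0 < α)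
    (hα' : α ≤ 1 / 8) (hε : 0 < ε) (hε' : ε ≤ 1 / 2) (hm : 1 ≤ m) (hg0 : 0 < g) (hg1 : g ≤ 1)
    (hginv : 1 / g ≤ 2 + 1 / (α * m)) (hT1 : 1 ≤ T) (hTlt : T < 8 * Real.log (16 / α) + 1)
    (hnlt : n < 75 * d * T / (ε * g) + 1) :
    n ≤ 10000 * rate d ε α m * Real.log (2 + rate d ε α m + 1 / α) := by
  have hmpos : (0 : ℝ) < m := by exact_mod_cast hm
  have hεg : 0 < ε * g := mul_pos hε hg0
  have h8 : 8 ≤ 1 / α := by rw [le_div_iff₀ hα]; linarith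
  have hrate : d / (ε * g) ≤ 2 * rate d ε α m := by
    have h1 : d / (ε * g) = d / ε * (1 / g) := by field_simp
    have h2 : d / ε * (2 + 1 / (α * m)) = 2 * (d / ε) + d / (ε * α * m) := by field_simp
    have h3 : d / ε * (1 / g) ≤ d / ε * (2 + 1 / (α * m)) :=
      mul_le_mul_of_nonneg_left hginv (by positivity)
    have h4 : 0 ≤ d / (ε * α * m) := by positivity
    rw [rate, h1]
    linarith
  have hrate0 : 0 ≤ rate d ε α m := by
    rw [rate]
    positivity
  set L := Real.log (2 + rate d ε α m + 1 / α) with hL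
  have hL1 : 1 ≤ L := by
    rw [hL, Real.le_log_iff_exp_le (by positivity)]
    have := Real.exp_one_lt_d9
    linarith
  have hlogα : Real.log (1 / α) ≤ L := Real.log_le_log (by positivity) (by linarith)
  have hlog2 : Real.log 2 ≤ L := Real.log_le_log (by positivity) (by linarith)
  have hlog : Real.log (16 / α) = 4 * Real.log 2 + Real.log (1 / α) := by
    rw [show (16 : ℝ) / α = 2 ^ 4 * (1 / α) by ring,
      Real.log_mul (by norm_num) (by positivity), Real.log_pow]
    norm_num
  have hT41 : (T : ℝ) ≤ 41 * L := by linarith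
  have h1 : (1 : ℝ) ≤ 2 * (d * T / (ε * g)) := by
    have h2 : ε * g ≤ 1 := mul_le_one₀ (by linarith) hg0.le hg1
    have h3 : 1 ≤ 2 * (d * T) := by
      have := mul_le_mul hd hT1 zero_le_one (by linarith)
      linarith
    rw [← mul_div_assoc, le_div_iff₀ hεg]
    linarith
  have h2 : 75 * d * T / (ε * g) = 75 * (d * T / (ε * g)) := by ring
  have h3 : d * T / (ε * g) = d / (ε * g) * T := by ring
  have h4 : d / (ε * g) * T ≤ 2 * rate d ε α m * (41 * L) := by
    apply mul_le_mul hrate hT41 (by linarith) (by linarith)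
  have h5 : 0 ≤ rate d ε α m * L := mul_nonneg hrate0 (by linarith)
  calc n ≤ 77 * (d / (ε * g) * T) := by rw [← h3]; linarith
    _ ≤ 77 * (2 * rate d ε α m * (41 * L)) := by linarith
    _ ≤ 10000 * rate d ε α m * L := by linarith

theorem exists_learner {X : Type*} {C : Set (X → Bool)} {P : PMF (Finset (X → Bool))}
    (hP : IsPR P C (1 / 4) (1 / 4)) {d : ℝ} (hd : 2 / 3 ≤ d)
    (hPd : prSize P ≤ ENNReal.ofReal (d + 1)) {α ε : ℝ} (hα : 0 < α) (hα' : α ≤ 1 / 8)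
    (hε : 0 < ε) (hε' : ε ≤ 1 / 2) {m : ℕ} (hm : 1 ≤ m) :
    ∃ n : ℕ, ∃ A : Algorithm (X × Bool) (X → Bool) n m, IsUserDP A ε 0 ∧
      IsUseful (pacTask C α) A (2 / 3) ∧
      (n : ℝ) ≤ 10000 * rate d ε α m * Real.log (2 + rate d ε α m + 1 / α) := by
  obtain ⟨μ, hμ⟩ := exists_covers_of_isPR hP (by linarith) hPd
  -- Half of `ε` pays for the weight, half for the normalization.
  set ρ := Real.exp (-(ε / 2)) with hρ
  have hρpos : 0 < ρ := Real.exp_pos _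
  have hρ1 : ρ ≤ 1 - ε / 4 := by
    have := exp_neg_le_one_sub_half (x := ε / 2) (by linarith) (by linarith)
    linarith
  have hρ0 : 1 / 2 ≤ ρ := by
    have := Real.one_sub_le_exp_neg (ε / 2)
    linarith
  -- Looking at more than `1/α` examples would make good hypotheses err too; the cap keeps `α k ≤
  -- 1`.
  set k := min m ⌊1 / α⌋₊ with hk
  have hfl : (⌊1 / α⌋₊ : ℝ) ≤ 1 / α := Nat.floor_le (by positivity)
  have hfl' : 1 / α < ⌊1 / α⌋₊ + 1 := Nat.lt_floor_add_one _
  have h8 : 8 ≤ 1 / α := by rw [le_div_iff₀ hα]; linarith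
  have hmpos : (0 : ℝ) < m := by exact_mod_cast hm
  set g := α * k with hg
  have hg1 : g ≤ 1 := by
    have h1 : (k : ℝ) ≤ ⌊1 / α⌋₊ := by exact_mod_cast min_le_right _ _
    calc g ≤ α * (1 / α) := mul_le_mul_of_nonneg_left (h1.trans hfl) hα.le
      _ = 1 := by field_simp
  have hg2 : 0 < g ∧ 1 / g ≤ 2 + 1 / (α * m) := by
    rcases min_choice m ⌊1 / α⌋₊ with h | h
    · have hgm : g = α * m := by rw [hg, hk, h]
      rw [hgm]
      exact ⟨by positivity, by linarith⟩
    · have hgh : 1 / 2 ≤ g := by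
        rw [hg, hk, h]
        have h1 : 1 / α / 2 ≤ (⌊1 / α⌋₊ : ℝ) := by linarith
        calc (1 / 2 : ℝ) = α * (1 / α / 2) := by field_simp
          _ ≤ _ := mul_le_mul_of_nonneg_left h1 hα.le
      refine ⟨by linarith, ?_⟩
      have h2 : 1 / g ≤ 2 := by rw [div_le_iff₀ (by linarith)]; linarith
      have h3 : 0 ≤ 1 / (α * m) := by positivity
      linarith
  obtain ⟨hg0, hginv⟩ := hg2
  -- Chosen so that `(7/8) ^ T ≤ exp (-T/8) ≤ α/16`.
  set T := ⌈8 * Real.log (16 / α)⌉₊ with hT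
  have hTle : 8 * Real.log (16 / α) ≤ T := Nat.le_ceil _
  have hlog16 : 0 < Real.log (16 / α) := Real.log_pos (by rw [lt_div_iff₀ hα]; linarith)
  have hT1 : (1 : ℝ) ≤ T := by
    have : 0 < T := Nat.ceil_pos.2 (by linarith)
    exact_mod_cast this
  have hTlt : (T : ℝ) < 8 * Real.log (16 / α) + 1 := Nat.ceil_lt_add_one (by linarith)
  have hboost : (7 / 8 : ℝ) ^ T ≤ α / 16 := by
    have h1 : (7 / 8 : ℝ) ≤ Real.exp (-(1 / 8)) := by
      have := Real.one_sub_le_exp_neg (1 / 8)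
      linarith
    calc (7 / 8 : ℝ) ^ T ≤ Real.exp (-(1 / 8)) ^ T := pow_le_pow_left₀ (by norm_num) h1 T
      _ = Real.exp (-(T / 8)) := by rw [← Real.exp_nat_mul]; congr 1; ring
      _ ≤ Real.exp (-Real.log (16 / α)) := Real.exp_le_exp.2 (by linarith)
      _ = α / 16 := by rw [Real.exp_neg, Real.exp_log (by positivity), inv_div]
  set q := (1 - 1 / 4 : ℝ) * Real.exp (-(d + 1)) with hq
  have hq0 : Real.exp (-(d + 2)) ≤ q := by
    have h1 : Real.exp (-1) ≤ 1 - 1 / 2 := exp_neg_le_one_sub_half zero_le_one le_rfl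
    calc Real.exp (-(d + 2)) = Real.exp (-1) * Real.exp (-(d + 1)) := by
          rw [← Real.exp_add]; congr 1; ring
      _ ≤ q := mul_le_mul_of_nonneg_right (by linarith) (Real.exp_nonneg _)
  have hqpos : 0 < q := (Real.exp_pos _).trans_le hq0
  have hq1 : q ≤ 1 := by
    have h1 : Real.exp (-(d + 1)) ≤ 1 := Real.exp_le_one_iff.2 (by linarith)
    rw [hq]
    linarith
  have hcov : Covers ((iid μ T).map majority) C (ENNReal.ofReal q ^ T)
      (ENNReal.ofReal (α / 16)) := by
    refine (hμ.boost (ENNReal.ofReal_le_one.2 hq1) T).mono ?_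
    rw [← ENNReal.ofReal_pow (by norm_num)]
    exact ENNReal.ofReal_le_ofReal hboost
  -- The decay per user is at least `3/32 · ε g`, and `75 · 3/32 ≥ 7`. The total exponent thus
  -- exceeds `7 d T ≥ T (d + 4) ≥ 2 + T (d + 2)`, where `d ≥ 2/3` is used.
  set n := ⌈75 * d * T / (ε * g)⌉₊ with hn
  have hεg : 0 < ε * g := by positivity
  have hnle : 75 * d * T / (ε * g) ≤ n := Nat.le_ceil _
  have hnlt : (n : ℝ) < 75 * d * T / (ε * g) + 1 := Nat.ceil_lt_add_one (by positivity)
  have hr : ENNReal.ofReal ρ ≤ 1 := ENNReal.ofReal_le_one.2 (by linarith)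
  have hr0 : ENNReal.ofReal ρ ≠ 0 := by simpa using hρpos
  refine ⟨n, learner n m k ((iid μ T).map majority) (ENNReal.ofReal ρ) hr hr0, ?_, ?_, ?_⟩
  · refine learner_isUserDP _ _ _ _ _ _ _ ?_
    rw [← ENNReal.ofReal_inv_of_pos hρpos, ← ENNReal.ofReal_mul (by positivity), hρ,
      ← Real.exp_neg, ← Real.exp_add]
    congr 2
    ring
  · refine learner_isUseful hr hr0 hρ0 (by linarith) (min_le_left _ _) hα.le (by linarith) hg1
      (pow_ne_zero _ (by simpa using hqpos)) hcov ?_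
    rw [← ENNReal.ofReal_pow hqpos.le, ← ENNReal.ofReal_mul (by norm_num)]
    set y := 3 / 8 * (1 - ρ) * (α * k) with hy
    have hy0 : 3 / 32 * (ε * g) ≤ y := by
      rw [hy, ← hg]
      nlinarith
    have hy1 : y ≤ 1 := by
      rw [hy, ← hg]
      nlinarith
    rw [← ENNReal.ofReal_pow (by linarith)]
    apply ENNReal.ofReal_le_ofReal
    have hyn : 2 + T * (d + 2) ≤ y * n := by
      have h1 : 75 * d * T ≤ n * (ε * g) := by rwa [div_le_iff₀ hεg] at hnle
      have h2 : 3 / 32 * (ε * g) * n ≤ y * n :=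
        mul_le_mul_of_nonneg_right hy0 (Nat.cast_nonneg n)
      have h3 : 2 + T * (d + 2) ≤ T * (d + 4) := by linarith
      have h4 : (T : ℝ) * (d + 4) ≤ T * (7 * d) :=
        mul_le_mul_of_nonneg_left (by linarith) (by linarith)
      have h5 : 0 ≤ (T : ℝ) * d := by positivity
      linarith
    have h3 : Real.exp (-2) ≤ 1 / 3 := by
      rw [Real.exp_neg, one_div]
      refine inv_anti₀ (by norm_num) ?_
      have := Real.add_one_le_exp (2 : ℝ)
      linarith
    calc (1 - y) ^ n ≤ Real.exp (-y) ^ n :=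
          pow_le_pow_left₀ (by linarith) (Real.one_sub_le_exp_neg y) n
      _ = Real.exp (-(y * n)) := by rw [← Real.exp_nat_mul]; congr 1; ring
      _ ≤ Real.exp (-2 + T * (-(d + 2))) := Real.exp_le_exp.2 (by linarith)
      _ = Real.exp (-2) * Real.exp (-(d + 2)) ^ T := by rw [Real.exp_add, Real.exp_nat_mul]
      _ ≤ 1 / 3 * q ^ T := by gcongr
  · exact sample_size_le hd hα hα' hε hε' hm hg0 hg1 hginv hT1 hTlt hnlt

/-! ### The lower bound by group privacy -/

open Classical in
theorem IsUserDP.group {Z O : Type*} {n m : ℕ} {A : Algorithm Z O n m} {ε : ℝ}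
    (hA : IsUserDP A ε 0) (S : Set O) (z' : Input Z n m) :
    ∀ (k : ℕ) (z : Input Z n m), (Finset.univ.filter fun i => z i ≠ z' i).card = k →
      (A z).toOuterMeasure S ≤ ENNReal.ofReal (Real.exp (ε * k)) * (A z').toOuterMeasure S
  | 0, z, h => by
    have hz : z = z' := by
      funext i
      by_contra hi
      have : i ∈ Finset.univ.filter fun i => z i ≠ z' i := by simpa using hi
      rw [Finset.card_eq_zero.1 h] at this
      simp at this
    simp [hz]
  | k + 1, z, h => by
    obtain ⟨i, hi⟩ := Finset.card_pos.1 (h.symm ▸ Nat.succ_pos k :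
      0 < (Finset.univ.filter fun i => z i ≠ z' i).card)
    have hset : (Finset.univ.filter fun j => Function.update z i (z' i) j ≠ z' j)
        = (Finset.univ.filter fun j => z j ≠ z' j).erase i := by
      ext j
      by_cases hj : j = i
      · subst hj; simp
      · simp [hj]
    have hcard : (Finset.univ.filter fun j => Function.update z i (z' i) j ≠ z' j).card = k := by
      rw [hset, Finset.card_erase_of_mem hi, h, Nat.add_sub_cancel]
    have h1 := hA z (Function.update z i (z' i))
      ⟨i, fun j hj => (Function.update_of_ne hj _ _).symm⟩ S
    rw [ENNReal.ofReal_zero, add_zero] at h1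
    refine h1.trans ((mul_le_mul_right (IsUserDP.group hA S z' k _ hcard) _).trans (le_of_eq ?_))
    rw [← mul_assoc, ← ENNReal.ofReal_mul (Real.exp_nonneg _), ← Real.exp_add]
    congr 3
    push_cast
    ring

/-- If few users differ from `u₀` on average, then any likely event keeps a large probability
when all users hold `u₀`. -/
theorem IsUserDP.toOuterMeasure_const_ge {Z O : Type*} {n m : ℕ} {A : Algorithm Z O n m} {ε : ℝ}
    (hε : 0 ≤ ε) (hA : IsUserDP A ε 0) (S : Set O) (U : PMF (Fin m → Z)) (u₀ : Fin m → Z)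
    {p : ℝ} (hp0 : 0 < p) (hp : U.toOuterMeasure {u | u ≠ u₀} ≤ ENNReal.ofReal p)
    (hS : ENNReal.ofReal (2 / 3) ≤ ((iid U n).bind A).toOuterMeasure S) :
    ENNReal.ofReal (7 / 12 * Real.exp (-(12 * ε * n * p))) ≤
      (A fun _ => u₀).toOuterMeasure S := by
  classical
  set t := 12 * ε * n * p with ht
  set a₀ := (A fun _ => u₀).toOuterMeasure S with ha₀
  rcases Nat.eq_zero_or_pos n with hn | hn
  · subst hn
    have h1 : ∀ z : Input Z 0 m, (A z).toOuterMeasure S = a₀ := fun z => by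
      rw [ha₀, Subsingleton.elim z fun _ => u₀]
    rw [toOuterMeasure_bind] at hS
    simp only [h1, ENNReal.tsum_mul_right, PMF.tsum_coe, one_mul] at hS
    refine le_trans (ENNReal.ofReal_le_ofReal ?_) hS
    simp [ht]
    norm_num
  have hn' : (0 : ℝ) < n := by exact_mod_cast hn
  have hK : ∀ z : Input Z n m, ((Finset.univ.filter fun i => z i ≠ u₀).card : ℝ≥0∞)
      = ∑ i, Set.indicator {u | u ≠ u₀} 1 (z i) := by
    intro z
    rw [Finset.card_filter]
    push_cast
    refine Finset.sum_congr rfl fun i _ => ?_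
    by_cases h : z i = u₀ <;> simp [h]
  -- Markov's inequality: more than `12 n p` users differ from `u₀` with probability at most `1/12`,
  -- which leaves `2/3 - 1/12 = 7/12`. That this exceeds `1/2` matters in `le_of_useful_of_pair`.
  set κ := ENNReal.ofReal (1 / (12 * n * p)) with hκ
  have hpt : ∀ z : Input Z n m, (A z).toOuterMeasure S ≤
      ENNReal.ofReal (Real.exp t) * a₀ + κ * ∑ i, Set.indicator {u | u ≠ u₀} 1 (z i) := by
    intro z
    rw [← hK]
    set K := (Finset.univ.filter fun i => z i ≠ u₀).card with hKdef
    by_cases hle : (K : ℝ) ≤ 12 * n * p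
    · refine le_trans (hA.group S (fun _ => u₀) K z (by rw [hKdef])) (le_add_right ?_)
      refine mul_le_mul_left (ENNReal.ofReal_le_ofReal (Real.exp_le_exp.2 ?_)) _
      calc ε * K ≤ ε * (12 * n * p) := mul_le_mul_of_nonneg_left hle hε
        _ = t := by rw [ht]; ring
    · refine (toOuterMeasure_le_one _ _).trans (le_add_left ?_)
      rw [hκ, ← ENNReal.ofReal_natCast, ← ENNReal.ofReal_mul (by positivity),
        ENNReal.one_le_ofReal, one_div_mul_eq_div, le_div_iff₀ (by positivity)]
      linarith
  have hsum : ENNReal.ofReal (2 / 3) ≤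
      ENNReal.ofReal (Real.exp t) * a₀ + ENNReal.ofReal (1 / 12) := by
    refine hS.trans ?_
    rw [toOuterMeasure_bind]
    calc ∑' z, iid U n z * (A z).toOuterMeasure S
        ≤ ∑' z, iid U n z * (ENNReal.ofReal (Real.exp t) * a₀
            + κ * ∑ i, Set.indicator {u | u ≠ u₀} 1 (z i)) :=
          ENNReal.tsum_le_tsum fun z => mul_le_mul_right (hpt z) _
      _ = ENNReal.ofReal (Real.exp t) * a₀ +
            κ * ∑ i : Fin n, ∑' z, iid U n z * Set.indicator {u | u ≠ u₀} 1 (z i) := by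
          simp only [mul_add, ENNReal.tsum_add, ENNReal.tsum_mul_right, PMF.tsum_coe, one_mul,
            mul_left_comm _ κ, Finset.mul_sum]
          rw [Summable.tsum_finsetSum fun _ _ => ENNReal.summable]
          simp only [ENNReal.tsum_mul_left]
      _ = ENNReal.ofReal (Real.exp t) * a₀ + κ * (n * U.toOuterMeasure {u | u ≠ u₀}) := by
          simp [tsum_iid_mul_coord, tsum_mul_indicator_one]
      _ ≤ ENNReal.ofReal (Real.exp t) * a₀ + κ * (n * ENNReal.ofReal p) := by gcongr
      _ = ENNReal.ofReal (Real.exp t) * a₀ + ENNReal.ofReal (1 / 12) := by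
          rw [hκ, ← ENNReal.ofReal_natCast, ← ENNReal.ofReal_mul hn'.le,
            ← ENNReal.ofReal_mul (by positivity)]
          congr 2
          field_simp
  have h7 : ENNReal.ofReal (7 / 12) ≤ ENNReal.ofReal (Real.exp t) * a₀ := by
    rw [show (7 / 12 : ℝ) = 2 / 3 - 1 / 12 by norm_num, ENNReal.ofReal_sub _ (by norm_num)]
    exact tsub_le_iff_right.2 hsum
  calc ENNReal.ofReal (7 / 12 * Real.exp (-t))
      = ENNReal.ofReal (Real.exp (-t)) * ENNReal.ofReal (7 / 12) := by
        rw [mul_comm, ENNReal.ofReal_mul (Real.exp_nonneg _)]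
    _ ≤ ENNReal.ofReal (Real.exp (-t)) * (ENNReal.ofReal (Real.exp t) * a₀) :=
        mul_le_mul_right h7 _
    _ = a₀ := by
        rw [← mul_assoc, ← ENNReal.ofReal_mul (Real.exp_nonneg _), ← Real.exp_add]
        simp

/-- The distribution that draws `x₀` with probability `1 - p` and a sample of `D` with
probability `p`. -/
noncomputable def dilute {X : Type*} (D : PMF X) (x₀ : X) (p : ℝ≥0) (hp : p ≤ 1) : PMF X :=
  (PMF.ofFintype (fun b : Bool => bif b then (p : ℝ≥0∞) else 1 - p) (by
    simpa using add_tsub_cancel_of_le (ENNReal.coe_le_one_iff.2 hp))).bind fun b => bif b then D else PMF.pure x₀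

theorem dilute_toOuterMeasure {X : Type*} (D : PMF X) (x₀ : X) (p : ℝ≥0) (hp : p ≤ 1)
    (S : Set X) :
    (dilute D x₀ p hp).toOuterMeasure S =
      p * D.toOuterMeasure S + (1 - p) * (PMF.pure x₀).toOuterMeasure S := by
  rw [dilute, toOuterMeasure_bind, tsum_bool, add_comm]
  simp

/-- Examples from `D` labelled by `c`. -/
noncomputable def labelled {X : Type*} (D : PMF X) (c : X → Bool) : PMF (X × Bool) :=
  D.map fun x => (x, c x)

theorem err_labelled {X : Type*} (D : PMF X) (c h : X → Bool) :
    err (labelled D c) h = D.toOuterMeasure {x | c x ≠ h x} := by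
  rw [err, labelled, PMF.toOuterMeasure_map_apply]
  congr 1
  ext x
  simp [eq_comm]

theorem toOuterMeasure_blank_ge {X : Type*} {C : Set (X → Bool)} {n m : ℕ} {α ε : ℝ}
    {A : Algorithm (X × Bool) (X → Bool) n m} (hα : 0 < α) (hα' : α ≤ 1 / 4) (hε : 0 ≤ ε)
    (hm : 1 ≤ m) (hA : IsUserDP A ε 0) (hU : IsUseful (pacTask C α) A (2 / 3)) (x₀ : X)
    {c : X → Bool} (hc : c ∈ C) (D : PMF X) :
    ENNReal.ofReal (7 / 12 * Real.exp (-(12 * ε * n * min 1 (4 * α * m)))) ≤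
      (A fun _ _ => (x₀, c x₀)).toOuterMeasure
        {h | D.toOuterMeasure {x | c x ≠ h x} ≤ ENNReal.ofReal (1 / 4)} := by
  have hmpos : (0 : ℝ) < m := by exact_mod_cast hm
  have hp1 : (4 * α).toNNReal ≤ 1 := Real.toNNReal_le_one.2 (by linarith)
  -- With weight `4α` on `D`, error `α` under `D'` forces error at most `1/4` under `D`.
  set D' := dilute D x₀ (4 * α).toNNReal hp1 with hD'
  have hvalid : labelled D' c ∈ (pacTask C α).valid := by
    refine ⟨c, hc, ?_⟩
    rw [err_labelled]
    simp
  have hblank : (labelled D' c).toOuterMeasure {z | z ≠ (x₀, c x₀)} ≤ ENNReal.ofReal (4 * α) := by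
    rw [labelled, PMF.toOuterMeasure_map_apply, hD', dilute_toOuterMeasure]
    have h1 : (PMF.pure x₀).toOuterMeasure ((fun x => (x, c x)) ⁻¹' {z | z ≠ (x₀, c x₀)}) = 0 := by
      simp [PMF.toOuterMeasure_pure_apply]
    rw [h1, mul_zero, add_zero]
    exact mul_le_of_le_one_right' (toOuterMeasure_le_one _ _)
  have hp : (iid (labelled D' c) m).toOuterMeasure {u | u ≠ fun _ => (x₀, c x₀)} ≤
      ENNReal.ofReal (min 1 (4 * α * m)) := by
    rcases min_choice 1 (4 * α * m) with h | h
    · rw [h, ENNReal.ofReal_one]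
      exact toOuterMeasure_le_one _ _
    · rw [h]
      have h1 : {u : Fin m → X × Bool | u ≠ fun _ => (x₀, c x₀)}
          = {u | ∃ i ∈ (Finset.univ : Finset (Fin m)), u i ∈ {z | z ≠ (x₀, c x₀)}} := by
        ext u
        simp [funext_iff]
      rw [h1]
      refine (iid_toOuterMeasure_exists_le _ _ _ _).trans ?_
      rw [Finset.card_univ, Fintype.card_fin, mul_comm (4 * α),
        ENNReal.ofReal_mul (Nat.cast_nonneg m), ENNReal.ofReal_natCast]
      gcongr
  refine (hA.toOuterMeasure_const_ge hε _ (iid (labelled D' c) m) _ (by positivity) hp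
    (hU _ hvalid)).trans (MeasureTheory.measure_mono ?_)
  intro h hh
  have h1 : err (labelled D' c) h ≤ ENNReal.ofReal α := hh
  rw [err_labelled, hD', dilute_toOuterMeasure] at h1
  have h2 : ENNReal.ofReal (4 * α) * D.toOuterMeasure {x | c x ≠ h x} ≤
      ENNReal.ofReal (4 * α) * ENNReal.ofReal (1 / 4) := by
    rw [← ENNReal.ofReal_mul (by linarith), show 4 * α * (1 / 4) = α by ring]
    exact (le_add_right le_rfl).trans h1
  exact (ENNReal.mul_le_mul_iff_right (by simpa using hα) ENNReal.ofReal_ne_top).1 h2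

theorem prDim_le_of_useful {X : Type*} {C : Set (X → Bool)} {n m : ℕ} {α ε : ℝ}
    {A : Algorithm (X × Bool) (X → Bool) n m} (hα : 0 < α) (hα' : α ≤ 1 / 4) (hε : 0 ≤ ε)
    (hm : 1 ≤ m) (hA : IsUserDP A ε 0) (hU : IsUseful (pacTask C α) A (2 / 3)) (x₀ : X) :
    prDim C ≤ ENNReal.ofReal (12 * ε * n * min 1 (4 * α * m) + 2) := by
  set t := 12 * ε * n * min 1 (4 * α * m) with ht
  have ht0 : 0 ≤ t := by positivity
  -- A fair coin guesses `c x₀`, the only trace of `c` in the blank input; this halves `7/12` to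
  -- `7/24`.
  let μ : PMF (X → Bool) := (PMF.uniformOfFintype Bool).bind fun b => A fun _ _ => (x₀, b)
  set q := 7 / 24 * Real.exp (-t) with hq
  have hμ : Covers μ C (ENNReal.ofReal q) (ENNReal.ofReal (1 / 4)) := by
    intro c hc D
    rw [toOuterMeasure_bind]
    refine le_trans ?_ (ENNReal.le_tsum (c x₀))
    have h1 := toOuterMeasure_blank_ge hα hα' hε hm hA hU x₀ hc D
    rw [PMF.uniformOfFintype_apply]
    have h2 : ((Fintype.card Bool : ℝ≥0∞))⁻¹ = ENNReal.ofReal (1 / 2) := by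
      rw [one_div, ENNReal.ofReal_inv_of_pos two_pos]; simp
    rw [h2]
    refine le_trans (le_of_eq ?_) (mul_le_mul_right h1 _)
    rw [← ENNReal.ofReal_mul (by norm_num), hq, ht]
    congr 1
    ring
  have hq0 : 0 < q := by positivity
  have hq1 : q ≤ 1 := by
    have : Real.exp (-t) ≤ 1 := Real.exp_le_one_iff.2 (by linarith)
    rw [hq]
    linarith
  -- Then `q N ≥ 7/4` with `exp (-7/4) ≤ 1/4`, while `N ≤ 7 exp t ≤ exp (t + 2)`.
  set N := ⌈6 * Real.exp t⌉₊ with hN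
  have hNle : 6 * Real.exp t ≤ N := Nat.le_ceil _
  have hexp : 1 ≤ Real.exp t := Real.one_le_exp ht0
  have hNlt : (N : ℝ) < 6 * Real.exp t + 1 := Nat.ceil_lt_add_one (by linarith)
  have hqN : 7 / 4 ≤ q * N := by
    calc (7 / 4 : ℝ) = 7 / 24 * Real.exp (-t) * (6 * Real.exp t) := by
          rw [mul_mul_mul_comm, ← Real.exp_add]; norm_num
      _ ≤ q * N := mul_le_mul_of_nonneg_left hNle hq0.le
  refine (prDim_le_of_covers hμ N ?_).trans (ENNReal.ofReal_le_ofReal ?_)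
  · rw [← ENNReal.ofReal_one, ← ENNReal.ofReal_sub _ hq0.le, ← ENNReal.ofReal_pow (by linarith)]
    apply ENNReal.ofReal_le_ofReal
    have h4 : Real.exp (-(7 / 4)) ≤ 1 / 4 := by
      rw [Real.exp_neg, one_div]
      refine inv_anti₀ (by norm_num) ?_
      have := Real.quadratic_le_exp_of_nonneg (x := 7 / 4) (by norm_num)
      linarith
    calc (1 - q) ^ N ≤ Real.exp (-q) ^ N :=
          pow_le_pow_left₀ (by linarith) (Real.one_sub_le_exp_neg q) N
      _ = Real.exp (-(q * N)) := by rw [← Real.exp_nat_mul]; congr 1; ring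
      _ ≤ Real.exp (-(7 / 4)) := Real.exp_le_exp.2 (by linarith)
      _ ≤ 1 / 4 := h4
  · rw [Real.log_le_iff_le_exp (by linarith), Real.exp_add]
    have h2 : (7 : ℝ) ≤ Real.exp 2 := by
      have h := Real.exp_one_gt_d9
      have : Real.exp 2 = Real.exp 1 * Real.exp 1 := by rw [← Real.exp_add]; norm_num
      rw [this]
      nlinarith
    nlinarith

/-- Both concepts give the same blank input at `y`, and point-mass marginals at `x` demand different
values there. Two disjoint events of probability at least `7/12 · exp (-t)` force `exp (-t) ≤ 6/7`,
so `t ≥ 1/7`. -/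
theorem le_of_useful_of_pair {X : Type*} {C : Set (X → Bool)} {n m : ℕ} {α ε : ℝ}
    {A : Algorithm (X × Bool) (X → Bool) n m} (hα : 0 < α) (hα' : α ≤ 1 / 4) (hε : 0 ≤ ε)
    (hm : 1 ≤ m) (hA : IsUserDP A ε 0) (hU : IsUseful (pacTask C α) A (2 / 3))
    {c c' : X → Bool} (hc : c ∈ C) (hc' : c' ∈ C) {x y : X} (hy : c y = c' y) (hx : c x ≠ c' x) :
    1 / 7 ≤ 12 * ε * n * min 1 (4 * α * m) := by
  set t := 12 * ε * n * min 1 (4 * α * m) with ht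
  have key : ∀ c ∈ C, ENNReal.ofReal (7 / 12 * Real.exp (-t)) ≤
      (A fun _ _ => (y, c y)).toOuterMeasure {h | h x = c x} := by
    intro c hc
    refine (toOuterMeasure_blank_ge hα hα' hε hm hA hU y hc (PMF.pure x)).trans
      (MeasureTheory.measure_mono ?_)
    intro h hh
    by_contra hne
    have h1 : (PMF.pure x).toOuterMeasure {x | c x ≠ h x} = 1 := by
      rw [PMF.toOuterMeasure_pure_apply]
      exact if_pos fun h2 => hne h2.symm
    simp only [Set.mem_ofPred_eq, h1] at hh
    norm_num at hh
  have h1 := key c hc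
  have h2 := key c' hc'
  rw [← hy] at h2
  have h3 := toOuterMeasure_add_compl (A fun _ _ => (y, c y)) {h | h x = c x}
  have h4 : {h : X → Bool | h x = c' x} ⊆ {h | h x = c x}ᶜ := by
    intro h hh hh'
    exact hx (Eq.trans (Eq.symm hh') hh)
  have h5 := add_le_add h1 (h2.trans (MeasureTheory.measure_mono h4))
  rw [h3, ← ENNReal.ofReal_add (by positivity) (by positivity), ENNReal.ofReal_le_one] at h5
  have h6 := Real.one_sub_le_exp_neg t
  linarith

/-! ### Degenerate classes and conclusion -/

theorem userComplexity_eq_find {Z O : Type*} {T : Task Z O} {m : ℕ} {ε δ γ : ℝ} {n₀ : ℕ}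
    (h : ∃ A : Algorithm Z O n₀ m, IsUserDP A ε δ ∧ IsUseful T A γ) :
    ∃ n : ℕ, userComplexity T m ε δ γ = (n : ℕ∞) ∧ n ≤ n₀ ∧
      ∃ A : Algorithm Z O n m, IsUserDP A ε δ ∧ IsUseful T A γ := by
  classical
  have hex : ∃ n : ℕ, ∃ A : Algorithm Z O n m, IsUserDP A ε δ ∧ IsUseful T A γ := ⟨n₀, h⟩
  refine ⟨Nat.find hex, le_antisymm (iInf₂_le (Nat.find hex) (Nat.find_spec hex)) ?_,
    Nat.find_min' hex h, Nat.find_spec hex⟩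
  exact le_iInf₂ fun n hn => by exact_mod_cast Nat.find_min' hex hn

/-- Under the point mass at `x`, a `1/4`-approximation is exact at `x`. Since `3/4 + 3/4 > 1`, some
`H` in the support serves both concepts and so has two elements. The resulting `d ≥ 2/3` absorbs
additive constants elsewhere. -/
theorem log_two_le_prDim {X : Type*} {C : Set (X → Bool)} {c c' : X → Bool} (hc : c ∈ C)
    (hc' : c' ∈ C) {x : X} (hx : c x ≠ c' x) : ENNReal.ofReal (Real.log 2) ≤ prDim C := by
  refine le_iInf₂ fun P hP => ?_
  have hmem : ∀ c ∈ C, ENNReal.ofReal (1 - 1 / 4) ≤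
      P.toOuterMeasure {H | ∃ h ∈ H, h x = c x} := by
    intro c hc
    refine (hP c hc (PMF.pure x)).trans (MeasureTheory.measure_mono ?_)
    rintro H ⟨h, hH, hh⟩
    refine ⟨h, hH, ?_⟩
    by_contra hne
    have h1 : (PMF.pure x).toOuterMeasure {x | c x ≠ h x} = 1 := by
      rw [PMF.toOuterMeasure_pure_apply]
      exact if_pos fun h2 => hne h2.symm
    rw [h1] at hh
    norm_num at hh
  have hex : ∃ H ∈ P.support, (∃ h ∈ H, h x = c x) ∧ ∃ h ∈ H, h x = c' x := by
    by_contra hno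
    push Not at hno
    have h3 := toOuterMeasure_add_compl P {H | ∃ h ∈ H, h x = c x}
    have h4 : P.toOuterMeasure {H | ∃ h ∈ H, h x = c' x} ≤
        P.toOuterMeasure {H | ∃ h ∈ H, h x = c x}ᶜ := by
      apply PMF.toOuterMeasure_mono
      rintro H ⟨⟨h', hH', hh'⟩, hS⟩ ⟨h, hH, hh⟩
      exact hno H hS ⟨h, hH, hh⟩ h' hH' hh'
    have h5 := add_le_add (hmem c hc) ((hmem c' hc').trans h4)
    rw [h3, ← ENNReal.ofReal_add (by norm_num) (by norm_num), ENNReal.ofReal_le_one] at h5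
    norm_num at h5
  obtain ⟨H, hH, ⟨h, hh, hhx⟩, h', hh', hhx'⟩ := hex
  refine le_trans ?_ (le_iSup₂ (f := fun H (_ : H ∈ P.support) =>
    ENNReal.ofReal (Real.log (H.card : ℝ))) H hH)
  apply ENNReal.ofReal_le_ofReal
  apply Real.log_le_log two_pos
  have : 1 < H.card := Finset.one_lt_card.2 ⟨h, hh, h', hh', fun he => hx (by
    rw [← hhx, ← hhx', he])⟩
  exact_mod_cast this

theorem prDim_singleton {X : Type*} (c : X → Bool) : prDim {c} = 0 := by
  have hμ : Covers (PMF.pure c) {c} 1 (ENNReal.ofReal (1 / 4)) := by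
    intro c' hc' D
    rw [Set.mem_singleton_iff] at hc'
    subst hc'
    rw [PMF.toOuterMeasure_pure_apply, if_pos]
    simp
  simpa using prDim_le_of_covers hμ 1 (by simp)

theorem userComplexity_singleton {X : Type*} (c : X → Bool) (α : ℝ) (m : ℕ) {ε : ℝ} :
    userComplexity (pacTask {c} α) m ε 0 (2 / 3) = 0 := by
  suffices h : IsUserDP (n := 0) (m := m) (fun _ : Input (X × Bool) 0 m => PMF.pure c) ε 0 ∧
      IsUseful (pacTask {c} α) (fun _ : Input (X × Bool) 0 m => PMF.pure c) (2 / 3) by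
    obtain ⟨n, hn, hn0, -⟩ := userComplexity_eq_find ⟨_, h⟩
    rw [hn, Nat.le_zero.1 hn0]
    rfl
  constructor
  · rintro x x' ⟨i, -⟩
    exact i.elim0
  · rintro D ⟨c', hc', hD⟩
    rw [Set.mem_singleton_iff] at hc'
    subst hc'
    rw [PMF.bind_const, PMF.toOuterMeasure_pure_apply, if_pos]
    · rw [ENNReal.ofReal_le_one]
      norm_num
    · change err D c' ≤ ENNReal.ofReal α
      rw [hD]
      exact zero_le

theorem exists_agreeing_pair {X : Type*} {C : Set (X → Bool)} {c : X → Bool} (hc : c ∈ C)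
    (hC : ∃ c' ∈ C, c' ≠ c) (hcompl : ¬ ∃ c : X → Bool, C = {c, fun x => !(c x)}) :
    ∃ a ∈ C, ∃ b ∈ C, ∃ x y, a y = b y ∧ a x ≠ b x := by
  by_contra hno
  push Not at hno
  have hneg : ∀ a ∈ C, ∀ b ∈ C, a ≠ b → b = fun x => !(a x) := by
    intro a ha b hb hab
    obtain ⟨x, hx⟩ := Function.ne_iff.1 hab
    funext y
    have h1 : a y ≠ b y := fun h => hx (hno a ha b hb x y h)
    cases h2 : a y <;> cases h3 : b y <;> simp_all
  obtain ⟨c', hc', hne⟩ := hC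
  refine hcompl ⟨c, Set.Subset.antisymm (fun b hb => ?_) ?_⟩
  · by_cases h : c = b
    · exact Or.inl h.symm
    · exact Or.inr (hneg c hc b hb h)
  · rintro b (rfl | hb)
    · exact hc
    · rw [Set.mem_singleton_iff.1 hb, ← hneg c hc c' hc' hne.symm]
      exact hc'

theorem exists_learner_of_prDim {X : Type*} {C : Set (X → Bool)} {d : ℝ≥0}
    (hC : prDim C = d) (hd : 2 / 3 ≤ (d : ℝ)) {α ε : ℝ} (hα : 0 < α) (hα' : α ≤ 1 / 8)
    (hε : 0 < ε) (hε' : ε ≤ 1 / 2) {m : ℕ} (hm : 1 ≤ m) :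
    ∃ n : ℕ, ∃ A : Algorithm (X × Bool) (X → Bool) n m, IsUserDP A ε 0 ∧
      IsUseful (pacTask C α) A (2 / 3) ∧
      (n : ℝ) ≤ 10000 * rate d ε α m * Real.log (2 + rate d ε α m + 1 / α) := by
  -- The slack `1` avoids showing that the infimum is attained.
  have hlt : prDim C < ENNReal.ofReal (d + 1) := by
    rw [hC, ← ENNReal.ofReal_coe_nnreal]
    exact (ENNReal.ofReal_lt_ofReal_iff (by positivity)).2 (by linarith)
  obtain ⟨P, hP⟩ := iInf_lt_iff.1 hlt
  obtain ⟨hPR, hP⟩ := iInf_lt_iff.1 hP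
  exact exists_learner hPR hd hP.le hα hα' hε hε' hm

theorem rate_le_of_le {d ε α n : ℝ} {m : ℕ} (hd : 0 ≤ d) (hα : 0 < α) (hε : 0 < ε) (hm : 1 ≤ m)
    (h : d / 28 ≤ 12 * ε * n * min 1 (4 * α * m)) : rate d ε α m ≤ 1680 * n := by
  have hmpos : (0 : ℝ) < m := by exact_mod_cast hm
  set p := min 1 (4 * α * m) with hp
  have hp0 : 0 < p := by positivity
  have hp1 : p ≤ 1 := min_le_left _ _
  have hp2 : p / (α * m) ≤ 4 := by
    rw [div_le_iff₀ (by positivity), ← mul_assoc]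
    exact min_le_right _ _
  have h1 : rate d ε α m * (ε * p) = d * (p + p / (α * m)) := by
    rw [rate]
    field_simp
  refine le_of_mul_le_mul_right ?_ (mul_pos hε hp0)
  have h2 : d * (p + p / (α * m)) ≤ d * 5 := mul_le_mul_of_nonneg_left (by linarith) hd
  linarith

theorem one_le_log_rate {d ε α : ℝ} {m : ℕ} (hd : 2 / 3 ≤ d) (hα : 0 < α) (hε : 0 < ε)
    (hε' : ε ≤ 1 / 2) : 1 ≤ Real.log (2 + rate d ε α m) := by
  have h1 : 4 / 3 ≤ d / ε := by
    rw [le_div_iff₀ hε]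
    linarith
  have h2 : 0 ≤ d / (ε * α * m) := by positivity
  rw [rate, Real.le_log_iff_exp_le (by linarith)]
  have := Real.exp_one_lt_d9
  linarith

theorem rate_le_of_useful {X : Type*} {C : Set (X → Bool)} {d : ℝ≥0} (hC : prDim C = d)
    {n m : ℕ} {α ε : ℝ} {A : Algorithm (X × Bool) (X → Bool) n m} (hα : 0 < α) (hα' : α ≤ 1 / 4)
    (hε : 0 < ε) (hm : 1 ≤ m) (hA : IsUserDP A ε 0) (hU : IsUseful (pacTask C α) A (2 / 3))
    {c c' : X → Bool} (hc : c ∈ C) (hc' : c' ∈ C) {x y : X} (hy : c y = c' y)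
    (hx : c x ≠ c' x) : rate d ε α m ≤ 1680 * n := by
  refine rate_le_of_le d.coe_nonneg hα hε hm ?_
  have h1 := le_of_useful_of_pair hα hα' hε.le hm hA hU hc hc' hy hx
  have h2 := prDim_le_of_useful hα hα' hε.le hm hA hU x
  rw [hC, ← ENNReal.ofReal_coe_nnreal, ENNReal.ofReal_le_ofReal_iff (by linarith)] at h2
  -- For `d ≤ 4` use `1/7 ≥ d/28`; for `d ≥ 4` use `d - 2 ≥ d/2`.
  rcases le_total (d : ℝ) 4 with h4 | h4 <;> linarith

end UserDP

theorem theorem1p2 :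
    ∃ α₀ : ℝ, 0 < α₀ ∧ ∃ ε₀ : ℝ, 0 < ε₀ ∧ ∃ a : ℝ, 0 < a ∧ ∃ b : ℝ, 0 < b ∧ ∃ k : ℕ,
      ∀ (X : Type u) (C : Set (X → Bool)), C.Nonempty →
      ∀ α ε : ℝ, 0 < α → α ≤ α₀ → 0 < ε → ε ≤ ε₀ →
      ∀ m : ℕ, 1 ≤ m →
        (UserDP.prDim C = ⊤ →
          UserDP.userComplexity (UserDP.pacTask C α) m ε 0 (2 / 3) = ⊤) ∧
        ∀ d : ℝ≥0, UserDP.prDim C = (d : ℝ≥0∞) →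
          ∃ n : ℕ, UserDP.userComplexity (UserDP.pacTask C α) m ε 0 (2 / 3) = (n : ℕ∞) ∧
            (n : ℝ) ≤ b * UserDP.rate d ε α m *
                Real.log (2 + UserDP.rate d ε α m + 1 / α) ^ k ∧
            ((¬ ∃ c : X → Bool, C = {c, fun x => !(c x)}) →
              a * UserDP.rate d ε α m / Real.log (2 + UserDP.rate d ε α m) ^ k ≤ (n : ℝ)) := by
  -- Here `1680 = 5 · 28 · 12`. The lower bound holds without a logarithm; the one in the statement
  -- is only used to be at least `1`.
  refine ⟨1 / 8, by norm_num, 1 / 2, by norm_num, 1 / 1680, by norm_num, 10000, by norm_num, 1,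
    ?_⟩
  rintro X C ⟨c, hc⟩ α ε hα hα' hε hε' m hm
  simp only [pow_one]
  by_cases hC : ∃ c' ∈ C, c' ≠ c
  · have hC' := hC
    obtain ⟨c', hc', hne⟩ := hC'
    obtain ⟨x, hx⟩ := Function.ne_iff.1 hne
    refine ⟨fun htop => ?_, fun d hd => ?_⟩
    · by_contra hfin
      obtain ⟨n, hn⟩ := iInf_lt_iff.1 (lt_top_iff_ne_top.2 hfin)
      obtain ⟨⟨A, hA, hU⟩, -⟩ := iInf_lt_iff.1 hn
      have := UserDP.prDim_le_of_useful hα (by linarith) hε.le hm hA hU x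
      rw [htop] at this
      exact ENNReal.ofReal_ne_top (top_le_iff.1 this)
    · have hd23 : 2 / 3 ≤ (d : ℝ) := by
        have h1 := UserDP.log_two_le_prDim hc' hc hx
        rw [hd, ← ENNReal.ofReal_coe_nnreal, ENNReal.ofReal_le_ofReal_iff d.coe_nonneg] at h1
        have := Real.log_two_gt_d9
        linarith
      obtain ⟨n₀, A₀, hA₀, hU₀, hn₀⟩ :=
        UserDP.exists_learner_of_prDim hd hd23 hα hα' hε hε' hm
      obtain ⟨n, hn, hle, A, hA, hU⟩ := UserDP.userComplexity_eq_find ⟨A₀, hA₀, hU₀⟩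
      refine ⟨n, hn, le_trans (by exact_mod_cast hle) hn₀, fun hcompl => ?_⟩
      obtain ⟨c₁, hc₁, c₂, hc₂, x, y, hy, hx⟩ := UserDP.exists_agreeing_pair hc hC hcompl
      have hrate := UserDP.rate_le_of_useful hd hα (by linarith) hε hm hA hU hc₁ hc₂ hy hx
      have hlog := UserDP.one_le_log_rate (m := m) hd23 hα hε hε'
      rw [div_le_iff₀ (by linarith)]
      have h1 : (n : ℝ) * 1 ≤ n * Real.log (2 + UserDP.rate d ε α m) :=
        mul_le_mul_of_nonneg_left hlog (Nat.cast_nonneg n)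
      linarith
  · have hsing : C = {c} := by
      push Not at hC
      exact Set.eq_singleton_iff_unique_mem.2 ⟨hc, hC⟩
    subst hsing
    refine ⟨fun htop => ?_, fun d hd => ⟨0, ?_, ?_, fun _ => ?_⟩⟩
    · rw [UserDP.prDim_singleton] at htop
      exact absurd htop ENNReal.zero_ne_top
    · rw [UserDP.userComplexity_singleton]
      rfl
    all_goals
      rw [UserDP.prDim_singleton] at hd
      have hd0 : d = 0 := by exact_mod_cast hd.symm
      simp [hd0, UserDP.rate]
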